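/- Let $(M,g)$ be a time-oriented Lorentzian manifold: $M$ is a smooth (Hausdorff) manifold of dimension $n+1\ge 1$, $g=\langle\cdot,\cdot\rangle$ is a smooth metric of signature $(-,+,\dots,+)$, and the time orientation is given by a smooth timelike vector field $T$. A tangent vector $v$ is timelike if $\langle v,v\rangle<0$ and null if $\langle v,v\rangle=0$ (so $0$ is null); a timelike or nonzero null vector $v$ is future-pointing if $\langle v,T\rangle<0$. Geodesics are those of the Levi-Civita connection, including constant ones. All curves are smooth and defined on $[0,1]$; a curve is timelike (null) if all its tangent vectors are timelike (null), and future-directed if all its nonzero tangent vectors are future-pointing; it is causal if every tangent vector $v$ satisfies $\langle v,v\rangle\le 0$. Then each point $p_0\in M$ has an open neighborhood $V\subset M$ such that the spacetime $(V,g)$ obtained by restricting $g$ to $V$ satisfies the following for all $p,q\in V$, where curves and geodesics are required to lie in $V$, $I^+(p)$ (respectively $J^+(p)$) denotes the set of points to which $p$ can be connected by a future-directed timelike (respectively future-directed causal) curve in $V$, and the closure is taken in $V$: 1. there exists a unique geodesic $c:[0,1]\to V$ with $c(0)=p$ and $c(1)=q$ (i.e. $V$ is geodesically convex); 2. $q\in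 I^+(p)$ if and only if there exists a future-directed timelike geodesic in $V$ connecting $p$ to $q$; 3. $J^+(p)=\overline{I^+(p)}$; 4. $q\in J^+(p)$ if and only if there exists a future-directed timelike or null geodesic in $V$ connecting $p$ to $q$ (the constant geodesic counts as a null geodesic when $q=p$). -/

import Mathlib

open Set Topology Bundle
open scoped Manifold ContDiff

noncomputable section

/-- A smooth Lorentzian metric on an `(n+1)`-dimensional smooth manifold `M`: a smooth symmetric
`2`-tensor field of signature `(-,+,…,+)` (hence nondegenerate) at every point. -/
structure LorentzianMetric (n : ℕ) (M : Type*) [TopologicalSpace M]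
    [ChartedSpace (EuclideanSpace ℝ (Fin (n + 1))) M] [IsManifold (𝓡 (n + 1)) ∞ M] where
  /-- The bilinear form `⟨·,·⟩` on each tangent space. -/
  inner (x : M) :
    TangentSpace (𝓡 (n + 1)) x →L[ℝ] TangentSpace (𝓡 (n + 1)) x →L[ℝ] ℝ
  symm (x : M) (v w : TangentSpace (𝓡 (n + 1)) x) : inner x v w = inner x w v
  signature (x : M) :
    ∃ b : Module.Basis (Fin (n + 1)) ℝ (TangentSpace (𝓡 (n + 1)) x),
      ∀ i j, inner x (b i) (b j) = if i = j then (if i = 0 then -1 else 1) else 0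
  contMDiff :
    ContMDiff (𝓡 (n + 1))
      ((𝓡 (n + 1)).prod 𝓘(ℝ, EuclideanSpace ℝ (Fin (n + 1)) →L[ℝ]
        EuclideanSpace ℝ (Fin (n + 1)) →L[ℝ] ℝ)) ∞
      (fun x => TotalSpace.mk' (EuclideanSpace ℝ (Fin (n + 1)) →L[ℝ]
        EuclideanSpace ℝ (Fin (n + 1)) →L[ℝ] ℝ) x (inner x))

namespace LorentzianMetric

variable {n : ℕ} {M : Type*} [TopologicalSpace M]
  [ChartedSpace (EuclideanSpace ℝ (Fin (n + 1))) M] [IsManifold (𝓡 (n + 1)) ∞ M]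

/-- A time orientation, given by a smooth timelike vector field `T`. -/
structure TimeOrientation (g : LorentzianMetric n M) where
  /-- The vector field. -/
  field (x : M) : TangentSpace (𝓡 (n + 1)) x
  timelike (x : M) : g.inner x (field x) (field x) < 0
  contMDiff :
    ContMDiff (𝓡 (n + 1)) ((𝓡 (n + 1)).prod 𝓘(ℝ, EuclideanSpace ℝ (Fin (n + 1)))) ∞
      (fun x => TotalSpace.mk' (EuclideanSpace ℝ (Fin (n + 1))) x (field x))

/-! ### Geodesics of the Levi-Civita connection -/

/-- The coefficients of the metric in the chart around `x₀`, as a bilinear form on the model space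
depending on the coordinate point `y`: the pullback of the metric under the inverse of the chart.
(Tangent spaces of `M` are by definition copies of the model space.) -/
def chartMetric (g : LorentzianMetric n M) (x₀ : M) (y : EuclideanSpace ℝ (Fin (n + 1))) :
    EuclideanSpace ℝ (Fin (n + 1)) →L[ℝ] EuclideanSpace ℝ (Fin (n + 1)) →L[ℝ] ℝ :=
  let φ := (extChartAt (𝓡 (n + 1)) x₀).symm
  let dφ : EuclideanSpace ℝ (Fin (n + 1)) →L[ℝ] EuclideanSpace ℝ (Fin (n + 1)) :=
    mfderiv 𝓘(ℝ, EuclideanSpace ℝ (Fin (n + 1))) (𝓡 (n + 1)) φ y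
  let G : EuclideanSpace ℝ (Fin (n + 1)) →L[ℝ] EuclideanSpace ℝ (Fin (n + 1)) →L[ℝ] ℝ :=
    g.inner (φ y)
  G.bilinearComp dφ dφ

/-- The Christoffel symbols of the second kind of the Levi-Civita connection in the chart around
`x₀`: `Γ(v,w)` is the vector with
`⟨Γ(v,w), z⟩ = ½ (∂_v ⟨w, z⟩ + ∂_w ⟨v, z⟩ - ∂_z ⟨v, w⟩)` for all constant `z`. -/
def christoffel (g : LorentzianMetric n M) (x₀ : M) (y v w : EuclideanSpace ℝ (Fin (n + 1))) :
    EuclideanSpace ℝ (Fin (n + 1)) :=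
  let dg := fderiv ℝ (g.chartMetric x₀) y
  (g.chartMetric x₀ y).inverse ((1 / 2 : ℝ) • (dg v w + dg w v - (dg.flip v).flip w))

/-- `c` restricted to `[0,1]` is a smooth curve. -/
def IsSmoothCurve (n : ℕ) {M : Type*} [TopologicalSpace M]
    [ChartedSpace (EuclideanSpace ℝ (Fin (n + 1))) M] (c : ℝ → M) : Prop :=
  ContMDiffOn 𝓘(ℝ, ℝ) (𝓡 (n + 1)) ∞ c (Icc 0 1)

/-- The tangent vector at time `t` of a curve defined on `[0,1]` (one-sided at the endpoints). -/
def velocity (n : ℕ) {M : Type*} [TopologicalSpace M]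
    [ChartedSpace (EuclideanSpace ℝ (Fin (n + 1))) M] (c : ℝ → M) (t : ℝ) :
    TangentSpace (𝓡 (n + 1)) (c t) :=
  mfderivWithin 𝓘(ℝ, ℝ) (𝓡 (n + 1)) c (Icc 0 1) t (1 : ℝ)

/-- `c : [0,1] → M` is a geodesic: a smooth curve which satisfies
`u'' + Γ(u', u') = 0` in local coordinates `u`. Constant curves are included. -/
def IsGeodesic (g : LorentzianMetric n M) (c : ℝ → M) : Prop :=
  IsSmoothCurve n c ∧
  ∀ x₀ : M, ∀ t ∈ Icc (0 : ℝ) 1, c t ∈ (extChartAt (𝓡 (n + 1)) x₀).source →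
    let u : ℝ → EuclideanSpace ℝ (Fin (n + 1)) := fun s => extChartAt (𝓡 (n + 1)) x₀ (c s)
    let u' : ℝ → EuclideanSpace ℝ (Fin (n + 1)) := derivWithin u (Icc 0 1)
    let u'' : ℝ → EuclideanSpace ℝ (Fin (n + 1)) := derivWithin u' (Icc 0 1)
    u'' t + g.christoffel x₀ (u t) (u' t) (u' t) = 0

/-! ### Causal character -/

/-- A vector `v` (timelike, or nonzero null) is future-pointing. -/
def FuturePointing (g : LorentzianMetric n M) (T : g.TimeOrientation) {x : M}
    (v : TangentSpace (𝓡 (n + 1)) x) : Prop :=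
  g.inner x v (T.field x) < 0

/-- Every tangent vector of `c : [0,1] → M` is timelike. -/
def IsTimelike (g : LorentzianMetric n M) (c : ℝ → M) : Prop :=
  ∀ t ∈ Icc (0 : ℝ) 1, g.inner (c t) (velocity n c t) (velocity n c t) < 0

/-- Every tangent vector of `c : [0,1] → M` is null; the zero vector is null. -/
def IsNull (g : LorentzianMetric n M) (c : ℝ → M) : Prop :=
  ∀ t ∈ Icc (0 : ℝ) 1, g.inner (c t) (velocity n c t) (velocity n c t) = 0

/-- Every tangent vector of `c : [0,1] → M` is timelike or null. -/
def IsNonSpacelike (g : LorentzianMetric n M) (c : ℝ → M) : Prop :=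
  ∀ t ∈ Icc (0 : ℝ) 1, g.inner (c t) (velocity n c t) (velocity n c t) ≤ 0

/-- Every nonzero tangent vector of `c : [0,1] → M` is future-pointing. -/
def IsFutureDirected (g : LorentzianMetric n M) (T : g.TimeOrientation) (c : ℝ → M) : Prop :=
  ∀ t ∈ Icc (0 : ℝ) 1, velocity n c t ≠ 0 → g.FuturePointing T (velocity n c t)

/-- `c : [0,1] → M` connects `p` to `q` inside `V`. -/
def Connects (V : Set M) (p q : M) (c : ℝ → M) : Prop :=
  c 0 = p ∧ c 1 = q ∧ MapsTo c (Icc 0 1) V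

/-- The chronological future `I⁺(p)` of `p` in the spacetime obtained by restricting the metric to
the open set `V`. -/
def chronologicalFuture (g : LorentzianMetric n M) (T : g.TimeOrientation) (V : Set M) (p : M) :
    Set M :=
  {q | ∃ c : ℝ → M, IsSmoothCurve n c ∧ Connects V p q c ∧
    g.IsTimelike c ∧ g.IsFutureDirected T c}

/-- The causal future `J⁺(p)` of `p` in the spacetime obtained by restricting the metric to
the open set `V`. -/
def causalFuture (g : LorentzianMetric n M) (T : g.TimeOrientation) (V : Set M) (p : M) :
    Set M :=
  {q | ∃ c : ℝ → M, IsSmoothCurve n c ∧ Connects V p q c ∧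
    g.IsNonSpacelike c ∧ g.IsFutureDirected T c}

/-- Any two points of `V` are joined by a geodesic in `V`, which is unique as a curve on `[0,1]`. -/
def GeodesicallyConvex (g : LorentzianMetric n M) (V : Set M) : Prop :=
  ∀ p ∈ V, ∀ q ∈ V,
    (∃ c : ℝ → M, g.IsGeodesic c ∧ Connects V p q c) ∧
    ∀ c₁ c₂ : ℝ → M, g.IsGeodesic c₁ → Connects V p q c₁ →
      g.IsGeodesic c₂ → Connects V p q c₂ → EqOn c₁ c₂ (Icc 0 1)

end LorentzianMetric

end

/-! Everything takes place in a chart around `p₀`, on a coordinate ball of radius `a` so small that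
the connection coefficients and their Lipschitz constant are bounded by `K` with `16 * K * a ≤ 1`.
The neighborhood `V` is the part of `M` over the concentric ball of radius `a / 16`.

Convexity. On this scale the geodesic equation is a small perturbation of `c'' = 0`. Picard-Lindelöf
solves it for small initial velocities, and the map from initial velocity to end point is close to
the identity, hence covers the small ball (`exists_geodesic`). The squared Euclidean distance to the
center is convex along geodesics, so they do not leave the ball (`mapsTo_ball`). Uniqueness follows
from `norm_velocity_le` and `comparison`, which bound the difference of two geodesics from one point
by the distance of their end points.

Causality. Let `v q` be the velocity of the geodesic from `p` to `q`, so that `v q 0` is the inverse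
exponential map, and let the energy of `q` be `G p (v q 0) (v q 0)`. A first variation formula with
quadratic error shows that its derivative at `q` is `2 • G q (v q 1)`, the Gauss lemma. Along a
future-directed timelike curve from `p` the radial velocity and the tangent vector lie in the same
cone, so the energy decreases and stays negative: the radial geodesic to the end point is timelike
and future-directed (`initialVelocity_timelike`). This is statement 2.

For 3 and 4, `v q 0` depends continuously on `q`, so a point of the closure of `I⁺(p)` in `V` is the
end of a causal radial geodesic. Conversely a causal curve `γ` is the limit of the timelike curves
`γ + ε (exp (l t) - 1) T`, which also start at `p` (`exists_timelike_perturbation`). -/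

set_option maxSynthPendingDepth 3

/-! ### Geodesics in a small coordinate ball -/

section CoordinateGeodesics

open Metric

variable {E : Type*} [NormedAddCommGroup E] [InnerProductSpace ℝ E]

/-- A version of the Picard-Lindelöf theorem which records that the solution stays in the ball on
which the vector field is controlled. -/
theorem IsPicardLindelof.exists_mem_closedBall_hasDerivWithinAt {F : Type*}
    [NormedAddCommGroup F] [NormedSpace ℝ F] [CompleteSpace F] {f : ℝ → F → F} {tmin tmax : ℝ}
    {t₀ : Icc tmin tmax} {x₀ x : F} {a r L K : NNReal} (hf : IsPicardLindelof f t₀ x₀ a r L K)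
    (hx : x ∈ closedBall x₀ r) :
    ∃ α : ℝ → F, α t₀ = x ∧ (∀ t, α t ∈ closedBall x₀ a) ∧
      ∀ t ∈ Icc tmin tmax, HasDerivWithinAt α (f t (α t)) (Icc tmin tmax) t := by
  obtain ⟨α, hα⟩ := ODE.FunSpace.exists_isFixedPt_next hf hx
  refine ⟨α.compProj, by rw [ODE.FunSpace.compProj_val, ← hα, ODE.FunSpace.next_apply₀],
    fun t => α.compProj_mem_closedBall hf.mul_max_le, fun t ht ↦ ?_⟩
  apply ODE.hasDerivWithinAt_picard_Icc t₀.2 hf.continuousOn_uncurry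
    α.continuous_compProj.continuousOn (fun _ ht' ↦ α.compProj_mem_closedBall hf.mul_max_le)
    x ht |>.congr_of_mem _ ht
  intro t' ht'
  nth_rw 1 [← hα]
  rw [ODE.FunSpace.compProj_of_mem ht', ODE.FunSpace.next_apply]

/-- `c` solves `c'' + Γ(c', c') = 0` on `[0,1]`, with velocity `v`. -/
structure CoordGeodesic (Γ : E → E →L[ℝ] E →L[ℝ] E) (c v : ℝ → E) : Prop where
  deriv : ∀ t ∈ Icc (0 : ℝ) 1, HasDerivWithinAt c (v t) (Icc 0 1) t
  deriv₂ : ∀ t ∈ Icc (0 : ℝ) 1, HasDerivWithinAt v (-(Γ (c t) (v t) (v t))) (Icc 0 1) t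

/-- Connection coefficients `Γ` with bounds that are small relative to the radius `a`. -/
structure SmallConnection (Γ : E → E →L[ℝ] E →L[ℝ] E) (x₀ : E) (a K : ℝ) : Prop where
  pos : 0 < a
  le_one : a ≤ 1
  nonneg : 0 ≤ K
  small : 16 * K * a ≤ 1
  norm_le : ∀ x ∈ closedBall x₀ a, ‖Γ x‖ ≤ K
  lipschitz : ∀ x ∈ closedBall x₀ a, ∀ y ∈ closedBall x₀ a, ‖Γ x - Γ y‖ ≤ K * ‖x - y‖

theorem norm_image_sub_le_of_hasDerivWithinAt_Icc {f f' : ℝ → E} {C : ℝ}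
    (hf : ∀ t ∈ Icc (0 : ℝ) 1, HasDerivWithinAt f (f' t) (Icc 0 1) t)
    (hC : ∀ t ∈ Icc (0 : ℝ) 1, ‖f' t‖ ≤ C) {s t : ℝ} (hs : s ∈ Icc (0 : ℝ) 1)
    (ht : t ∈ Icc (0 : ℝ) 1) : ‖f t - f s‖ ≤ C * |t - s| :=
  Convex.norm_image_sub_le_of_norm_hasDerivWithin_le hf hC (convex_Icc 0 1) hs ht

theorem norm_image_sub_le_of_hasDerivWithinAt_unitInterval {f f' : ℝ → E} {C : ℝ}
    (hf : ∀ t ∈ Icc (0 : ℝ) 1, HasDerivWithinAt f (f' t) (Icc 0 1) t)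
    (hC : ∀ t ∈ Icc (0 : ℝ) 1, ‖f' t‖ ≤ C) {s t : ℝ} (hs : s ∈ Icc (0 : ℝ) 1)
    (ht : t ∈ Icc (0 : ℝ) 1) : ‖f t - f s‖ ≤ C := by
  refine (norm_image_sub_le_of_hasDerivWithinAt_Icc hf hC hs ht).trans ?_
  have h0 : 0 ≤ C := (norm_nonneg _).trans (hC s hs)
  have : |t - s| ≤ 1 := abs_le.2 ⟨by linarith [hs.2, ht.1], by linarith [hs.1, ht.2]⟩
  nlinarith

/-- The increment of a function over `[0,1]` differs from any of its velocities by at most the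
bound on the oscillation of the velocity. -/
theorem norm_image_sub_sub_deriv_le {f f' : ℝ → E} {C : ℝ}
    (hf : ∀ t ∈ Icc (0 : ℝ) 1, HasDerivWithinAt f (f' t) (Icc 0 1) t) {t : ℝ}
    (hC : ∀ s ∈ Icc (0 : ℝ) 1, ‖f' s - f' t‖ ≤ C) : ‖f 1 - f 0 - f' t‖ ≤ C := by
  have hg : ∀ s ∈ Icc (0 : ℝ) 1,
      HasDerivWithinAt (fun s => f s - s • f' t) (f' s - f' t) (Icc 0 1) s := fun s hs => by
    simpa using! (hf s hs).sub ((hasDerivWithinAt_id s (Icc 0 1)).smul_const (f' t))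
  have := norm_image_sub_le_of_hasDerivWithinAt_unitInterval hg hC
    (left_mem_Icc.2 zero_le_one) (right_mem_Icc.2 zero_le_one)
  convert this using 2
  simp; abel

namespace CoordGeodesic

variable {Γ : E → E →L[ℝ] E →L[ℝ] E} {c v : ℝ → E}

theorem continuousOn (h : CoordGeodesic Γ c v) : ContinuousOn c (Icc 0 1) :=
  fun t ht => (h.deriv t ht).continuousWithinAt

theorem continuousOn_velocity (h : CoordGeodesic Γ c v) : ContinuousOn v (Icc 0 1) :=
  fun t ht => (h.deriv₂ t ht).continuousWithinAt

theorem const (Γ : E → E →L[ℝ] E →L[ℝ] E) (p : E) :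
    CoordGeodesic Γ (fun _ => p) (fun _ => 0) where
  deriv t _ := hasDerivWithinAt_const t _ p
  deriv₂ t _ := by simpa using hasDerivWithinAt_const t _ (0 : E)

end CoordGeodesic

/-! ### A priori bounds, comparison and existence of geodesics. -/

namespace SmallConnection

variable {Γ : E → E →L[ℝ] E →L[ℝ] E} {x₀ : E} {a K : ℝ}

theorem norm_apply_le (h : SmallConnection Γ x₀ a K) {x : E} (hx : x ∈ closedBall x₀ a)
    (v w : E) : ‖Γ x v w‖ ≤ K * ‖v‖ * ‖w‖ :=
  ((Γ x).le_opNorm₂ v w).trans (by gcongr; exact h.norm_le x hx)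

theorem norm_apply_sub_le (h : SmallConnection Γ x₀ a K) {x y : E} (hx : x ∈ closedBall x₀ a)
    (hy : y ∈ closedBall x₀ a) (v w : E) :
    ‖Γ x v v - Γ y w w‖ ≤ K * ‖x - y‖ * ‖v‖ * ‖v‖ + K * (‖v‖ + ‖w‖) * ‖v - w‖ := by
  have e : Γ x v v - Γ y w w = (Γ x - Γ y) v v + Γ y (v - w) v + Γ y w (v - w) := by
    simp only [sub_apply, map_sub]; abel
  have h1 : ‖(Γ x - Γ y) v v‖ ≤ K * ‖x - y‖ * ‖v‖ * ‖v‖ :=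
    ((Γ x - Γ y).le_opNorm₂ v v).trans (by gcongr; exact h.lipschitz x hx y hy)
  rw [e]
  calc _ ≤ ‖(Γ x - Γ y) v v‖ + ‖Γ y (v - w) v‖ + ‖Γ y w (v - w)‖ := norm_add₃_le
    _ ≤ K * ‖x - y‖ * ‖v‖ * ‖v‖ + K * ‖v - w‖ * ‖v‖ + K * ‖w‖ * ‖v - w‖ := by
        gcongr
        · exact h.norm_apply_le hy _ _
        · exact h.norm_apply_le hy _ _
    _ = _ := by ring

/-- A geodesic which stays in a small ball has small velocity. -/
theorem norm_velocity_le (h : SmallConnection Γ x₀ a K) {ρ : ℝ} (hρ : ρ ≤ a) {c v : ℝ → E}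
    (hc : CoordGeodesic Γ c v) (hmem : MapsTo c (Icc 0 1) (closedBall x₀ ρ)) {t : ℝ}
    (ht : t ∈ Icc (0 : ℝ) 1) : ‖v t‖ ≤ 8 * ρ := by
  obtain ⟨t₀, ht₀, hmax⟩ := isCompact_Icc.exists_isMaxOn ⟨t, ht⟩ hc.continuousOn_velocity.norm
  refine (hmax ht).trans ?_
  set m := ‖v t₀‖ with hm
  have hm0 : 0 ≤ m := norm_nonneg _
  have hK := h.nonneg
  have hmem' : MapsTo c (Icc 0 1) (closedBall x₀ a) := hmem.mono_right (closedBall_subset_closedBall hρ)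
  have hρ0 : 0 ≤ ρ := dist_nonneg.trans (mem_closedBall.1 (hmem ht))
  have hacc : ∀ s ∈ Icc (0 : ℝ) 1, ‖-(Γ (c s) (v s) (v s))‖ ≤ K * m * m := fun s hs => by
    rw [norm_neg]
    refine (h.norm_apply_le (hmem' hs) _ _).trans ?_
    gcongr <;> exact hmax hs
  -- Compare the chord over a time `η` from the point of maximal speed `m` with the tangent: the
  -- chord is at most `2 * ρ` long, the deviation at most `K m² η²`. Since `η ≤ 1 / 2`, one of `t₀ ±
  -- η` lies in `[0,1]`.
  have key : ∀ η : ℝ, 0 ≤ η → η ≤ 1 / 2 → m * η ≤ 2 * ρ + K * m * m * η * η := by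
    intro η h0 h1
    obtain ⟨s, hs, hst⟩ : ∃ s ∈ Icc (0 : ℝ) 1, |s - t₀| = η := by
      rcases le_total t₀ (1 / 2) with h2 | h2
      · exact ⟨t₀ + η, ⟨by linarith [ht₀.1], by linarith⟩, by simp [abs_of_nonneg h0]⟩
      · exact ⟨t₀ - η, ⟨by linarith, by linarith [ht₀.2]⟩, by simp [abs_of_nonneg h0]⟩
    have hseg : uIcc t₀ s ⊆ Icc 0 1 := uIcc_subset_Icc ht₀ hs
    have hg : ∀ τ ∈ uIcc t₀ s, HasDerivWithinAt (fun τ => c τ - τ • v t₀) (v τ - v t₀)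
        (uIcc t₀ s) τ := fun τ hτ => by
      simpa using! ((hc.deriv τ (hseg hτ)).mono hseg).sub
        ((hasDerivWithinAt_id τ _).smul_const (v t₀))
    have hb : ∀ τ ∈ uIcc t₀ s, ‖v τ - v t₀‖ ≤ K * m * m * η := fun τ hτ => by
      refine (norm_image_sub_le_of_hasDerivWithinAt_Icc hc.deriv₂ hacc ht₀ (hseg hτ)).trans ?_
      gcongr
      rw [← hst]
      exact abs_sub_left_of_mem_uIcc hτ
    have h3 := Convex.norm_image_sub_le_of_norm_hasDerivWithin_le hg hb (convex_uIcc t₀ s)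
      left_mem_uIcc right_mem_uIcc
    rw [Real.norm_eq_abs, hst] at h3
    have e : (s - t₀) • v t₀ = (c s - x₀) - (c t₀ - x₀)
        - ((c s - s • v t₀) - (c t₀ - t₀ • v t₀)) := by
      rw [sub_smul]; abel
    have h4 : ‖(s - t₀) • v t₀‖ = m * η := by
      rw [norm_smul, Real.norm_eq_abs, hst, mul_comm]
    rw [← h4, e]
    have h5 := mem_closedBall_iff_norm.1 (hmem hs)
    have h6 := mem_closedBall_iff_norm.1 (hmem ht₀)
    calc _ ≤ ‖(c s - x₀) - (c t₀ - x₀)‖ + ‖((c s - s • v t₀) - (c t₀ - t₀ • v t₀))‖ :=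
          norm_sub_le _ _
      _ ≤ (‖c s - x₀‖ + ‖c t₀ - x₀‖) + _ := by gcongr; exact norm_sub_le _ _
      _ ≤ _ := by linarith
  -- If `K m ≤ 1`, then `η = 1/2` gives `m / 2 ≤ 2ρ + m / 4`. Otherwise `η = 1 / (2 K m)` gives `1 ≤
  -- 8 K ρ ≤ 8 K a`, against `16 K a ≤ 1`.
  rcases le_or_gt (K * m) 1 with h1 | h1
  · have := key (1 / 2) (by norm_num) le_rfl
    nlinarith
  · have hm1 : 0 < m := by
      rcases hm0.eq_or_lt with h2 | h2
      · rw [← h2] at h1; norm_num at h1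
      · exact h2
    have hK1 : 0 < K := by
      rcases hK.eq_or_lt with h2 | h2
      · rw [← h2] at h1; norm_num at h1
      · exact h2
    have h2 := key (1 / (2 * (K * m))) (by positivity) (by
      rw [div_le_div_iff₀ (by positivity) (by positivity)]; linarith)
    have h3 : m * (1 / (2 * (K * m))) = 1 / (2 * K) := by field_simp
    have h4 : K * m * m * (1 / (2 * (K * m))) * (1 / (2 * (K * m))) = 1 / (4 * K) := by
      field_simp; norm_num
    rw [h3, h4] at h2
    have h5 : 1 / (2 * K) = 2 * (1 / (4 * K)) := by field_simp; norm_num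
    have h6 : 1 / (4 * K) ≤ 2 * ρ := by linarith
    rw [div_le_iff₀ (by positivity)] at h6
    nlinarith [h.small]

/-- Two geodesics with the same starting point: the distance of their velocities is controlled
by that of the initial velocities and by that of the end points. -/
theorem comparison (h : SmallConnection Γ x₀ a K) {c₁ v₁ c₂ v₂ : ℝ → E}
    (h₁ : CoordGeodesic Γ c₁ v₁) (h₂ : CoordGeodesic Γ c₂ v₂)
    (m₁ : MapsTo c₁ (Icc 0 1) (closedBall x₀ a)) (m₂ : MapsTo c₂ (Icc 0 1) (closedBall x₀ a))
    (b₁ : ∀ t ∈ Icc (0 : ℝ) 1, ‖v₁ t‖ ≤ a) (b₂ : ∀ t ∈ Icc (0 : ℝ) 1, ‖v₂ t‖ ≤ a)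
    (h0 : c₁ 0 = c₂ 0) :
    ∃ D : ℝ, (∀ t ∈ Icc (0 : ℝ) 1, ‖v₁ t - v₂ t‖ ≤ D) ∧
      (∀ t ∈ Icc (0 : ℝ) 1, ‖c₁ t - c₂ t‖ ≤ D) ∧ D ≤ 4 / 3 * ‖v₁ 0 - v₂ 0‖ ∧
      D ≤ 4 / 3 * ‖c₁ 1 - c₂ 1‖ ∧ ‖c₁ 1 - c₂ 1 - (v₁ 0 - v₂ 0)‖ ≤ D / 4 := by
  have z : (0 : ℝ) ∈ Icc (0 : ℝ) 1 := left_mem_Icc.2 zero_le_one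
  obtain ⟨t₀, ht₀, hmax⟩ := isCompact_Icc.exists_isMaxOn ⟨0, z⟩
    (h₁.continuousOn_velocity.sub h₂.continuousOn_velocity).norm
  set D := ‖v₁ t₀ - v₂ t₀‖ with hD
  have hD0 : 0 ≤ D := norm_nonneg _
  have hv : ∀ t ∈ Icc (0 : ℝ) 1, ‖v₁ t - v₂ t‖ ≤ D := fun t ht => hmax ht
  have hd : ∀ t ∈ Icc (0 : ℝ) 1,
      HasDerivWithinAt (fun t => c₁ t - c₂ t) (v₁ t - v₂ t) (Icc 0 1) t :=
    fun t ht => (h₁.deriv t ht).sub (h₂.deriv t ht)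
  have hc : ∀ t ∈ Icc (0 : ℝ) 1, ‖c₁ t - c₂ t‖ ≤ D := fun t ht => by
    simpa [h0] using norm_image_sub_le_of_hasDerivWithinAt_unitInterval hd hv z ht
  have hd₂ : ∀ t ∈ Icc (0 : ℝ) 1, HasDerivWithinAt (fun t => v₁ t - v₂ t)
      (-(Γ (c₁ t) (v₁ t) (v₁ t)) - -(Γ (c₂ t) (v₂ t) (v₂ t))) (Icc 0 1) t :=
    fun t ht => (h₁.deriv₂ t ht).sub (h₂.deriv₂ t ht)
  -- The accelerations differ by at most `3 K a D ≤ 3 D / 16`. So the velocity difference varies by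
  -- at most `D / 4` over `[0,1]`; absorbing this into its maximum `D` produces the factors `4 / 3`.
  have hacc : ∀ t ∈ Icc (0 : ℝ) 1,
      ‖-(Γ (c₁ t) (v₁ t) (v₁ t)) - -(Γ (c₂ t) (v₂ t) (v₂ t))‖ ≤ D / 4 := fun t ht => by
    rw [neg_sub_neg, norm_sub_rev]
    refine (h.norm_apply_sub_le (m₁ ht) (m₂ ht) _ _).trans ?_
    have hK := h.nonneg
    have ha := h.pos
    calc _ ≤ K * D * a * a + K * (a + a) * D := by
          gcongr
          exacts [hc t ht, b₁ t ht, b₁ t ht, b₁ t ht, b₂ t ht, hv t ht]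
      _ = K * a * (a + 2) * D := by ring
      _ ≤ K * a * (1 + 2) * D := by gcongr; exact h.le_one
      _ ≤ D / 4 := by nlinarith [h.small, mul_nonneg hK ha.le]
  have osc : ∀ t ∈ Icc (0 : ℝ) 1, ∀ s ∈ Icc (0 : ℝ) 1,
      ‖(v₁ s - v₂ s) - (v₁ t - v₂ t)‖ ≤ D / 4 := fun t ht s hs =>
    norm_image_sub_le_of_hasDerivWithinAt_unitInterval hd₂ hacc ht hs
  refine ⟨D, hv, hc, ?_, ?_, ?_⟩
  · have := osc 0 z t₀ ht₀
    have := norm_sub_norm_le (v₁ t₀ - v₂ t₀) (v₁ 0 - v₂ 0)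
    linarith
  · have h1 := norm_image_sub_sub_deriv_le hd (osc t₀ ht₀)
    simp only [h0, sub_self, sub_zero] at h1
    have := norm_sub_norm_le (v₁ t₀ - v₂ t₀) (c₁ 1 - c₂ 1)
    rw [norm_sub_rev] at h1
    linarith
  · have h1 := norm_image_sub_sub_deriv_le hd (osc 0 z)
    simpa only [h0, sub_self, sub_zero] using h1

/-- Convexity of the distance function along geodesics: a geodesic with end points in a small
ball, and which is known to stay in a larger one, stays in the small ball. -/
theorem mapsTo_ball (h : SmallConnection Γ x₀ a K) {c v : ℝ → E} (hc : CoordGeodesic Γ c v)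
    (hmem : MapsTo c (Icc 0 1) (closedBall x₀ a)) {ρ : ℝ} (h0 : c 0 ∈ ball x₀ ρ)
    (h1 : c 1 ∈ ball x₀ ρ) : MapsTo c (Icc 0 1) (ball x₀ ρ) := by
  have z : (0 : ℝ) ∈ Icc (0 : ℝ) 1 := left_mem_Icc.2 zero_le_one
  have o : (1 : ℝ) ∈ Icc (0 : ℝ) 1 := right_mem_Icc.2 zero_le_one
  have hf : ∀ t ∈ Icc (0 : ℝ) 1, HasDerivWithinAt (fun t => ‖c t - x₀‖ ^ 2)
      (2 * inner ℝ (c t - x₀) (v t)) (Icc 0 1) t := fun t ht =>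
    ((hc.deriv t ht).sub_const x₀).norm_sq
  have hf' : ∀ t ∈ Icc (0 : ℝ) 1, HasDerivWithinAt (fun t => 2 * inner ℝ (c t - x₀) (v t))
      (2 * (inner ℝ (c t - x₀) (-(Γ (c t) (v t) (v t))) + inner ℝ (v t) (v t))) (Icc 0 1) t :=
    fun t ht => (((hc.deriv t ht).sub_const x₀).inner ℝ (hc.deriv₂ t ht)).const_mul 2
  -- The second derivative is `2 (‖v‖² - ⟪c - x₀, Γ(v, v)⟫)`, nonnegative because `a * K ≤ 1`.
  have hconv : ConvexOn ℝ (Icc 0 1) (fun t => ‖c t - x₀‖ ^ 2) := by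
    refine convexOn_of_hasDerivWithinAt2_nonneg (convex_Icc 0 1)
      (fun t ht => (hf t ht).continuousWithinAt)
      (fun t ht => (hf t (interior_subset ht)).mono interior_subset)
      (fun t ht => (hf' t (interior_subset ht)).mono interior_subset) fun t ht => ?_
    have ht := interior_subset ht
    have e1 := abs_real_inner_le_norm (c t - x₀) (-(Γ (c t) (v t) (v t)))
    have e2 := h.norm_apply_le (hmem ht) (v t) (v t)
    have e3 := mem_closedBall_iff_norm.1 (hmem ht)
    rw [norm_neg] at e1
    rw [real_inner_self_eq_norm_sq]
    have e4 : ‖c t - x₀‖ * ‖Γ (c t) (v t) (v t)‖ ≤ a * (K * ‖v t‖ * ‖v t‖) := by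
      gcongr
      exact h.pos.le
    have e5 : a * (K * ‖v t‖ * ‖v t‖) ≤ ‖v t‖ ^ 2 := by
      nlinarith [h.small, sq_nonneg (‖v t‖), mul_nonneg h.nonneg h.pos.le]
    have := (abs_le.1 (e1.trans (e4.trans e5))).1
    linarith
  intro t ht
  have := hconv.le_max_of_mem_Icc z o ht
  rw [mem_ball_iff_norm] at h0 h1 ⊢
  have hρ : 0 < ρ := (norm_nonneg _).trans_lt h0
  have : ‖c t - x₀‖ ^ 2 < ρ ^ 2 := this.trans_lt (max_lt (by gcongr) (by gcongr))
  exact lt_of_pow_lt_pow_left₀ 2 hρ.le this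

/-- A geodesic whose velocity vanishes at one point has velocity zero. -/
theorem velocity_eq_zero (h : SmallConnection Γ x₀ a K) {c v : ℝ → E} (hc : CoordGeodesic Γ c v)
    (hmem : MapsTo c (Icc 0 1) (closedBall x₀ a)) (hb : ∀ t ∈ Icc (0 : ℝ) 1, ‖v t‖ ≤ a)
    {s t : ℝ} (hs : s ∈ Icc (0 : ℝ) 1) (h0 : v s = 0) (ht : t ∈ Icc (0 : ℝ) 1) : v t = 0 := by
  obtain ⟨t₀, ht₀, hmax⟩ := isCompact_Icc.exists_isMaxOn ⟨t, ht⟩ hc.continuousOn_velocity.norm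
  -- One factor of the quadratic term is bounded by `a`, which leaves a linear bound by the maximal
  -- speed; integrating from the zero of `v`, that maximum is at most `K * a ≤ 1 / 16` times itself.
  have hacc : ∀ s ∈ Icc (0 : ℝ) 1, ‖-(Γ (c s) (v s) (v s))‖ ≤ K * a * ‖v t₀‖ := fun s hs => by
    rw [norm_neg]
    refine (h.norm_apply_le (hmem hs) _ _).trans ?_
    have := h.nonneg
    have := h.pos
    gcongr
    · exact hb s hs
    · exact hmax hs
  have h1 := norm_image_sub_le_of_hasDerivWithinAt_unitInterval hc.deriv₂ hacc hs ht₀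
  rw [h0, sub_zero] at h1
  have h2 : ‖v t₀‖ = 0 := by nlinarith [norm_nonneg (v t₀), h.small]
  exact norm_le_zero_iff.1 ((hmax ht).trans h2.le)

variable [CompleteSpace E]

theorem exists_geodesic_of_velocity (h : SmallConnection Γ x₀ a K) {p w : E}
    (hp : p ∈ closedBall x₀ (a / 2)) (hw : ‖w‖ ≤ a / 4) :
    ∃ c v : ℝ → E, CoordGeodesic Γ c v ∧ c 0 = p ∧ v 0 = w ∧
      MapsTo c (Icc 0 1) (closedBall x₀ a) ∧ ∀ t ∈ Icc (0 : ℝ) 1, ‖v t‖ ≤ a := by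
  have ha := h.pos
  have hK := h.nonneg
  obtain ⟨A, hA⟩ : ∃ A : NNReal, (A : ℝ) = a := ⟨⟨a, ha.le⟩, rfl⟩
  -- The second component of the state is twice the velocity, so that the whole field carries a
  -- factor `1 / 2`. On the ball of radius `a` it is then bounded by `a / 2`, exactly what a
  -- solution starting within `a / 2` of the center can afford over unit time.
  let f : ℝ → E × E → E × E := fun _ z => (1 / 2 : ℝ) • (z.2, -(Γ z.1 z.2 z.2))
  have hball : ∀ z ∈ closedBall ((x₀, 0) : E × E) a, z.1 ∈ closedBall x₀ a ∧ ‖z.2‖ ≤ a := by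
    intro z hz
    rw [← closedBall_prod_same, mem_prod] at hz
    exact ⟨hz.1, mem_closedBall_zero_iff.1 hz.2⟩
  have hPL : IsPicardLindelof f (tmin := 0) (tmax := 1) ⟨0, left_mem_Icc.2 zero_le_one⟩ (x₀, 0)
      A (A / 2) (A / 2) 1 := by
    refine ⟨fun t _ => ?_, fun x _ => continuousOn_const, fun t _ z hz => ?_, ?_⟩ <;>
      simp only [NNReal.coe_div, NNReal.coe_ofNat, hA] at *
    · refine LipschitzOnWith.of_dist_le_mul fun z hz w hw => ?_
      obtain ⟨z1, z2⟩ := hball z hz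
      obtain ⟨w1, w2⟩ := hball w hw
      simp only [f, dist_eq_norm, ← smul_sub, norm_smul, Prod.mk_sub_mk, NNReal.coe_one, one_mul]
      have e1 : ‖z.1 - w.1‖ ≤ ‖z - w‖ := norm_fst_le (z - w)
      have e2 : ‖z.2 - w.2‖ ≤ ‖z - w‖ := norm_snd_le (z - w)
      have e3 : ‖-(Γ z.1 z.2 z.2) - -(Γ w.1 w.2 w.2)‖ ≤ ‖z - w‖ := by
        rw [neg_sub_neg, norm_sub_rev]
        refine (h.norm_apply_sub_le z1 w1 _ _).trans ?_
        calc _ ≤ K * ‖z - w‖ * a * a + K * (a + a) * ‖z - w‖ := by gcongr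
          _ = K * a * (a + 2) * ‖z - w‖ := by ring
          _ ≤ K * a * (1 + 2) * ‖z - w‖ := by gcongr; exact h.le_one
          _ ≤ ‖z - w‖ := by nlinarith [h.small, mul_nonneg hK ha.le, norm_nonneg (z - w)]
      have e4 : ‖(z.2 - w.2, -(Γ z.1 z.2 z.2) - -(Γ w.1 w.2 w.2))‖ ≤ ‖z - w‖ := max_le e2 e3
      rw [Real.norm_of_nonneg (by norm_num)]
      linarith [norm_nonneg (z - w)]
    · obtain ⟨z1, z2⟩ := hball z hz
      have e1 : ‖-(Γ z.1 z.2 z.2)‖ ≤ a := by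
        rw [norm_neg]
        refine (h.norm_apply_le z1 _ _).trans ?_
        calc _ ≤ K * a * a := by gcongr
          _ ≤ a := by nlinarith [h.small]
      have e2 : ‖(z.2, -(Γ z.1 z.2 z.2))‖ ≤ a := max_le z2 e1
      simp only [f, norm_smul]
      rw [Real.norm_of_nonneg (by norm_num)]
      linarith
    · simp; linarith
  have hx : ((p, (2 : ℝ) • w) : E × E) ∈
      closedBall ((x₀, 0) : E × E) ((A / 2 : NNReal) : ℝ) := by
    rw [← closedBall_prod_same, NNReal.coe_div, NNReal.coe_ofNat, hA]
    refine ⟨hp, mem_closedBall_zero_iff.2 ?_⟩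
    simp only [norm_smul, Real.norm_ofNat]
    linarith
  obtain ⟨α, h0, hmem, hder⟩ := hPL.exists_mem_closedBall_hasDerivWithinAt hx
  rw [hA] at hmem
  refine ⟨fun t => (α t).1, fun t => (1 / 2 : ℝ) • (α t).2, ⟨?_, ?_⟩, ?_, ?_,
    fun t _ => (hball _ (hmem t)).1, fun t _ => ?_⟩
  · intro t ht
    exact (hder t ht).fst
  · intro t ht
    have h2 : HasDerivWithinAt (fun t => (α t).2) (f t (α t)).2 (Icc 0 1) t := (hder t ht).snd
    simpa [f] using! h2.const_smul (1 / 2 : ℝ)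
  · simp [h0]
  · simp [h0, smul_smul]
  · have := (hball _ (hmem t)).2
    simp only [norm_smul]
    rw [Real.norm_of_nonneg (by norm_num)]
    linarith [norm_nonneg (α t).2]

/-- Any two points of the small ball are joined by a geodesic. -/
theorem exists_geodesic (h : SmallConnection Γ x₀ a K) {p q : E} (hp : p ∈ ball x₀ (a / 16))
    (hq : q ∈ ball x₀ (a / 16)) :
    ∃ c v : ℝ → E, CoordGeodesic Γ c v ∧ c 0 = p ∧ c 1 = q ∧
      MapsTo c (Icc 0 1) (ball x₀ (a / 16)) := by
  have ha := h.pos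
  have hp' : p ∈ closedBall x₀ (a / 2) :=
    ball_subset_closedBall (ball_subset_ball (by linarith) hp)
  have hex : ∀ w : E, ∃ c v : ℝ → E, ‖w‖ ≤ a / 4 → CoordGeodesic Γ c v ∧ c 0 = p ∧ v 0 = w ∧
      MapsTo c (Icc 0 1) (closedBall x₀ a) ∧ ∀ t ∈ Icc (0 : ℝ) 1, ‖v t‖ ≤ a := fun w => by
    by_cases hw : ‖w‖ ≤ a / 4
    · obtain ⟨c, v, hcv⟩ := h.exists_geodesic_of_velocity hp' hw
      exact ⟨c, v, fun _ => hcv⟩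
    · exact ⟨fun _ => 0, fun _ => 0, fun h' => absurd h' hw⟩
  choose c v hcv using hex
  -- The end point map minus the identity has Lipschitz constant `(1 / 4) * (4 / 3) = 1 / 3`, by
  -- `comparison`.
  have happ : ApproximatesLinearOn (fun w => c w 1) (ContinuousLinearEquiv.refl ℝ E : E →L[ℝ] E)
      (closedBall 0 (a / 4)) (1 / 3) := by
    intro w₁ hw₁ w₂ hw₂
    obtain ⟨g₁, p₁, i₁, m₁, b₁⟩ := hcv w₁ (mem_closedBall_zero_iff.1 hw₁)
    obtain ⟨g₂, p₂, i₂, m₂, b₂⟩ := hcv w₂ (mem_closedBall_zero_iff.1 hw₂)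
    obtain ⟨D, -, -, h3, -, h5⟩ := h.comparison g₁ g₂ m₁ m₂ b₁ b₂ (p₁.trans p₂.symm)
    rw [i₁, i₂] at h3 h5
    simp only [ContinuousLinearEquiv.coe_refl, ContinuousLinearMap.coe_id', id_eq]
    push_cast
    linarith
  have hz : ‖(0 : E)‖ ≤ a / 4 := by simp; positivity
  have hc0 : c 0 1 = p := by
    obtain ⟨g₁, p₁, i₁, m₁, b₁⟩ := hcv 0 hz
    obtain ⟨D, -, h2, h3, -, -⟩ := h.comparison g₁ (CoordGeodesic.const Γ p) m₁
      (fun _ _ => closedBall_subset_closedBall (by linarith) hp') b₁ (fun _ _ => by simpa using ha.le)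
      p₁
    have := h2 1 (right_mem_Icc.2 zero_le_one)
    rw [i₁] at h3
    simp only [sub_self, norm_zero, mul_zero] at h3
    exact sub_eq_zero.1 (norm_le_zero_iff.1 (this.trans h3))
  let r : (ContinuousLinearEquiv.refl ℝ E : E →L[ℝ] E).NonlinearRightInverse :=
    ⟨id, 1, fun y => by simp, fun y => by simp⟩
  have hsurj := happ.surjOn_closedBall_of_nonlinearRightInverse r (ε := a / 4) (b := 0)
    (by positivity) subset_rfl
  -- The image contains the ball of radius `(1 - 1 / 3) * (a / 4) = a / 6` around `p`, and `q` is
  -- within `a / 8` of `p`.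
  have hq' : q ∈ closedBall (c 0 1) (((r.nnnorm : ℝ)⁻¹ - ((1 / 3 : NNReal) : ℝ)) * (a / 4)) := by
    have e : ((r.nnnorm : ℝ)⁻¹ - ((1 / 3 : NNReal) : ℝ)) * (a / 4) = a / 6 := by
      simp only [r]; push_cast; ring
    rw [hc0, e, mem_closedBall]
    have := dist_triangle_right q p x₀
    rw [mem_ball] at hp hq
    linarith
  obtain ⟨w, hw, hwq⟩ := hsurj hq'
  obtain ⟨g, p₁, -, m, -⟩ := hcv w (mem_closedBall_zero_iff.1 hw)
  have hwq : c w 1 = q := hwq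
  exact ⟨c w, v w, g, p₁, hwq, h.mapsTo_ball g m (p₁ ▸ hp) (hwq ▸ hq)⟩

end SmallConnection

end CoordinateGeodesics

/-! ### Cones of a Lorentzian form -/

section LorentzForm

variable {W : Type*} [AddCommGroup W] [Module ℝ W] [TopologicalSpace W]

/-- Two causal vectors in the same half space with respect to a timelike vector `T`, one of them
timelike, have negative product. -/
theorem lorentzForm_apply_neg {β : W →L[ℝ] W →L[ℝ] ℝ} (hsymm : ∀ v w, β v w = β w v) {T : W}
    (horth : ∀ v, v ≠ 0 → β v T = 0 → 0 < β v v) {v w : W} (hv : β v v < 0) (hvT : β v T < 0)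
    (hw : β w w ≤ 0) (hwT : β w T < 0) : β v w < 0 := by
  by_contra! hvw
  -- With this `l`, `w - l • v` is orthogonal to `T`. If `β v w ≥ 0`, its square is `β w w - 2 l β v
  -- w + l² β v v < 0`, although the orthogonal complement of `T` is spacelike.
  set l := β w T / β v T with hl
  have hl0 : 0 < l := div_pos_of_neg_of_neg hwT hvT
  have hu : β (w - l • v) T = 0 := by
    simp only [map_sub, map_smul, sub_apply, smul_apply, smul_eq_mul, hl]
    rw [div_mul_cancel₀ _ hvT.ne, sub_self]
  have hneg : β (w - l • v) (w - l • v) < 0 := by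
    simp only [map_sub, map_smul, sub_apply, smul_apply, smul_eq_mul]
    rw [hsymm w v]
    nlinarith [mul_nonneg hl0.le hvw, mul_pos hl0 hl0]
  rcases eq_or_ne (w - l • v) 0 with h | h
  · simp [h] at hneg
  · exact absurd (horth _ h hu) (not_lt.2 hneg.le)

/-- The half space that contains a causal vector is the same for two timelike vectors in the same
cone. -/
theorem lorentzForm_apply_neg_iff {β : W →L[ℝ] W →L[ℝ] ℝ} (hsymm : ∀ v w, β v w = β w v) {T S : W}
    (horth : ∀ v, v ≠ 0 → β v T = 0 → 0 < β v v) (hS : β S S < 0) (hST : β S T < 0)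
    {v : W} (hv0 : v ≠ 0) (hv : β v v ≤ 0) : β v S < 0 ↔ β v T < 0 := by
  have hne : β v T ≠ 0 := fun h => absurd (horth v hv0 h) (not_lt.2 hv)
  constructor
  · intro h
    by_contra! h'
    have hpos : 0 < β v T := lt_of_le_of_ne h' hne.symm
    have := lorentzForm_apply_neg hsymm horth hS hST (w := -v) (by simpa using hv) (by simpa)
    rw [map_neg, hsymm] at this
    linarith
  · intro h
    rw [hsymm]
    exact lorentzForm_apply_neg hsymm horth hS hST hv h

end LorentzForm

/-- Derivatives of the energy and of the inverse exponential map are read off from estimates with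
quadratic error, so smooth dependence of geodesics on their data is never needed. -/
theorem hasFDerivAt_of_norm_sub_le_sq {E F : Type*} [NormedAddCommGroup E] [NormedSpace ℝ E]
    [NormedAddCommGroup F] [NormedSpace ℝ F] {f : E → F} {f' : E →L[ℝ] F} {x : E} {s : Set E}
    (hs : s ∈ 𝓝 x) {C : ℝ} (h : ∀ y ∈ s, ‖f y - f x - f' (y - x)‖ ≤ C * ‖y - x‖ ^ 2) :
    HasFDerivAt f f' x := by
  have hO : (fun y => f y - f x - f' (y - x)) =O[𝓝 x] fun y => ‖y - x‖ ^ 2 :=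
    Asymptotics.IsBigO.of_bound C (Filter.mem_of_superset hs fun y hy => by
      simpa using h y hy)
  have h0 := hO.hasFDerivAt (𝕜 := ℝ) one_lt_two
  have h1 := (h0.add (f'.hasFDerivAt.sub_const (f' x))).add_const (f x)
  rw [zero_add] at h1
  refine h1.congr_of_eventuallyEq (Filter.Eventually.of_forall fun y => ?_)
  simp

/-! ### Local causality in a small coordinate ball -/

section LocalCausality

open Metric

variable {E : Type*} [NormedAddCommGroup E] [InnerProductSpace ℝ E]

/-- A Lorentzian metric `G` on a coordinate ball, with bounds `N` on its derivatives up to order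
two, a constant timelike vector `T`, and with `Γ` the coefficients of its Levi-Civita connection,
which are small relative to the radius. -/
structure LorentzBall (G : E → E →L[ℝ] E →L[ℝ] ℝ) (Γ : E → E →L[ℝ] E →L[ℝ] E) (T x₀ : E)
    (a K N : ℝ) : Prop extends SmallConnection Γ x₀ a K where
  symm : ∀ x v w, G x v w = G x w v
  differentiableAt : ∀ x ∈ closedBall x₀ a, DifferentiableAt ℝ G x
  metric_norm_le : ∀ x ∈ closedBall x₀ a, ‖G x‖ ≤ N
  fderiv_norm_le : ∀ x ∈ closedBall x₀ a, ‖fderiv ℝ G x‖ ≤ N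
  fderiv_lipschitz : ∀ x ∈ closedBall x₀ a, ∀ y ∈ closedBall x₀ a,
    ‖fderiv ℝ G x - fderiv ℝ G y‖ ≤ N * ‖x - y‖
  christoffel : ∀ x ∈ closedBall x₀ a, ∀ v z,
    G x (Γ x v v) z = fderiv ℝ G x v v z - 1 / 2 * fderiv ℝ G x z v v
  timelike : ∀ x ∈ closedBall x₀ a, G x T T < 0
  spacelike : ∀ x ∈ closedBall x₀ a, ∀ v, v ≠ 0 → G x v T = 0 → 0 < G x v v

namespace LorentzBall

variable {G : E → E →L[ℝ] E →L[ℝ] ℝ} {Γ : E → E →L[ℝ] E →L[ℝ] E} {T x₀ : E} {a K N : ℝ}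

theorem bound_nonneg (h : LorentzBall G Γ T x₀ a K N) : 0 ≤ N :=
  (norm_nonneg _).trans (h.metric_norm_le x₀ (mem_closedBall_self h.pos.le))

theorem continuousOn (h : LorentzBall G Γ T x₀ a K N) : ContinuousOn G (closedBall x₀ a) :=
  fun x hx => (h.differentiableAt x hx).continuousAt.continuousWithinAt

theorem ball_subset (h : LorentzBall G Γ T x₀ a K N) : ball x₀ (a / 16) ⊆ closedBall x₀ a :=
  ball_subset_closedBall.trans (closedBall_subset_closedBall (by linarith [h.pos]))

theorem taylor (h : LorentzBall G Γ T x₀ a K N) {x y : E} (hx : x ∈ closedBall x₀ a)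
    (hy : y ∈ closedBall x₀ a) : ‖G y - G x - fderiv ℝ G x (y - x)‖ ≤ N * ‖y - x‖ * ‖y - x‖ := by
  have hseg := (convex_closedBall x₀ a).segment_subset hx hy
  refine (convex_segment x y).norm_image_sub_le_of_norm_hasFDerivWithin_le'
    (fun z hz => (h.differentiableAt z (hseg hz)).hasFDerivAt.hasFDerivWithinAt)
    (fun z hz => ?_) (left_mem_segment ℝ x y) (right_mem_segment ℝ x y)
  refine (h.fderiv_lipschitz z (hseg hz) x hx).trans ?_
  have := h.bound_nonneg
  gcongr
  simpa [dist_eq_norm, norm_sub_rev x y] using (mem_closedBall.1 (segment_subset_closedBall_left x y hz))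

theorem hasDerivWithinAt_metric (h : LorentzBall G Γ T x₀ a K N) {c v w c' v' w' : ℝ → E}
    {s : Set ℝ} {t : ℝ} (hmem : c t ∈ closedBall x₀ a) (hc : HasDerivWithinAt c (c' t) s t)
    (hv : HasDerivWithinAt v (v' t) s t) (hw : HasDerivWithinAt w (w' t) s t) :
    HasDerivWithinAt (fun t => G (c t) (v t) (w t))
      (fderiv ℝ G (c t) (c' t) (v t) (w t) + G (c t) (v' t) (w t) + G (c t) (v t) (w' t)) s t := by
  have h1 := (h.differentiableAt _ hmem).hasFDerivAt.comp_hasDerivWithinAt t hc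
  exact (h1.clm_apply hv).clm_apply hw

/-- The speed of a geodesic is constant. -/
theorem speed_eq (h : LorentzBall G Γ T x₀ a K N) {c v : ℝ → E} (hc : CoordGeodesic Γ c v)
    (hmem : MapsTo c (Icc 0 1) (closedBall x₀ a)) {t : ℝ} (ht : t ∈ Icc (0 : ℝ) 1) :
    G (c t) (v t) (v t) = G (c 0) (v 0) (v 0) := by
  have hd : ∀ t ∈ Icc (0 : ℝ) 1, HasDerivWithinAt (fun t => G (c t) (v t) (v t)) 0 (Icc 0 1) t :=
    fun t ht => by
      convert! h.hasDerivWithinAt_metric (c' := v) (v' := fun t => -(Γ (c t) (v t) (v t)))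
        (w' := fun t => -(Γ (c t) (v t) (v t))) (hmem ht) (hc.deriv t ht) (hc.deriv₂ t ht)
        (hc.deriv₂ t ht) using 1
      -- The Christoffel identity with `z = v` makes `2 G(Γ(v, v), v)` equal to the derivative of
      -- `G` along `v`, evaluated on `(v, v)`.
      rw [h.symm (c t) (v t) _, map_neg, neg_apply, h.christoffel _ (hmem ht)]
      ring
  have := norm_image_sub_le_of_hasDerivWithinAt_Icc (C := 0) hd (by simp)
    (left_mem_Icc.2 zero_le_one) ht
  rw [zero_mul] at this
  exact sub_eq_zero.1 (norm_le_zero_iff.1 this)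

/-- The first variation of the energy, with a quadratic error term. -/
theorem first_variation (h : LorentzBall G Γ T x₀ a K N) {c₁ v₁ c₂ v₂ : ℝ → E}
    (h₁ : CoordGeodesic Γ c₁ v₁) (h₂ : CoordGeodesic Γ c₂ v₂)
    (m₁ : MapsTo c₁ (Icc 0 1) (closedBall x₀ a)) (m₂ : MapsTo c₂ (Icc 0 1) (closedBall x₀ a))
    (b₁ : ∀ t ∈ Icc (0 : ℝ) 1, ‖v₁ t‖ ≤ a) (b₂ : ∀ t ∈ Icc (0 : ℝ) 1, ‖v₂ t‖ ≤ a)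
    (h0 : c₁ 0 = c₂ 0) :
    ‖G (c₂ 0) (v₂ 0) (v₂ 0) - G (c₁ 0) (v₁ 0) (v₁ 0) - 2 * G (c₁ 1) (v₁ 1) (c₂ 1 - c₁ 1)‖
      ≤ 8 * N * ‖c₂ 1 - c₁ 1‖ ^ 2 := by
  obtain ⟨D, hv, hc, -, hD, -⟩ := h.comparison h₂ h₁ m₂ m₁ b₂ b₁ h0.symm
  have z : (0 : ℝ) ∈ Icc (0 : ℝ) 1 := left_mem_Icc.2 zero_le_one
  have o : (1 : ℝ) ∈ Icc (0 : ℝ) 1 := right_mem_Icc.2 zero_le_one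
  have hD0 : 0 ≤ D := (norm_nonneg _).trans (hv 0 z)
  have hN := h.bound_nonneg
  set κ := G (c₂ 0) (v₂ 0) (v₂ 0) - G (c₁ 0) (v₁ 0) (v₁ 0) with hκ
  -- This function vanishes at `0`, where the curves meet, and its value at `1` is the quantity to
  -- estimate. Its derivative is of second order in the difference of the curves.
  have hd : ∀ t ∈ Icc (0 : ℝ) 1,
      HasDerivWithinAt (fun t => t * κ - 2 * G (c₁ t) (v₁ t) (c₂ t - c₁ t))
      (κ - 2 * (fderiv ℝ G (c₁ t) (v₁ t) (v₁ t) (c₂ t - c₁ t)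
        + G (c₁ t) (-(Γ (c₁ t) (v₁ t) (v₁ t))) (c₂ t - c₁ t)
        + G (c₁ t) (v₁ t) (v₂ t - v₁ t))) (Icc 0 1) t := fun t ht => by
    have := h.hasDerivWithinAt_metric (c' := v₁) (v' := fun t => -(Γ (c₁ t) (v₁ t) (v₁ t)))
      (w := fun t => c₂ t - c₁ t) (w' := fun t => v₂ t - v₁ t) (m₁ ht) (h₁.deriv t ht)
      (h₁.deriv₂ t ht) ((h₂.deriv t ht).sub (h₁.deriv t ht))
    convert! ((hasDerivWithinAt_id t (Icc 0 1)).mul_const κ).sub (this.const_mul 2) using 1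
    simp
  have hb : ∀ t ∈ Icc (0 : ℝ) 1,
      ‖κ - 2 * (fderiv ℝ G (c₁ t) (v₁ t) (v₁ t) (c₂ t - c₁ t)
        + G (c₁ t) (-(Γ (c₁ t) (v₁ t) (v₁ t))) (c₂ t - c₁ t)
        + G (c₁ t) (v₁ t) (v₂ t - v₁ t))‖ ≤ 4 * N * D * D := fun t ht => by
    -- By constancy of speed, `κ` may be evaluated at time `t`. Expanding it around `(c₁, v₁)`, the
    -- geodesic equation cancels the first order terms; what remains is the Taylor remainder of `G`
    -- and products of two differences.
    have e : κ - 2 * (fderiv ℝ G (c₁ t) (v₁ t) (v₁ t) (c₂ t - c₁ t)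
        + G (c₁ t) (-(Γ (c₁ t) (v₁ t) (v₁ t))) (c₂ t - c₁ t) + G (c₁ t) (v₁ t) (v₂ t - v₁ t))
        = (G (c₂ t) - G (c₁ t) - fderiv ℝ G (c₁ t) (c₂ t - c₁ t)) (v₂ t) (v₂ t)
          + fderiv ℝ G (c₁ t) (c₂ t - c₁ t) (v₂ t) (v₂ t - v₁ t)
          + fderiv ℝ G (c₁ t) (c₂ t - c₁ t) (v₂ t - v₁ t) (v₁ t)
          + G (c₁ t) (v₂ t - v₁ t) (v₂ t - v₁ t) := by
      rw [hκ, ← h.speed_eq h₂ m₂ ht, ← h.speed_eq h₁ m₁ ht, map_neg, neg_apply,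
        h.christoffel _ (m₁ ht)]
      simp only [map_sub, sub_apply]
      rw [h.symm (c₁ t) (v₂ t) (v₁ t)]
      ring
    have d1 := hc t ht
    have d2 := hv t ht
    have d3 := (b₁ t ht).trans h.le_one
    have d4 := (b₂ t ht).trans h.le_one
    have n1 := h.metric_norm_le _ (m₁ ht)
    have n2 : ‖fderiv ℝ G (c₁ t) (c₂ t - c₁ t)‖ ≤ N * D :=
      (ContinuousLinearMap.le_opNorm _ _).trans (by gcongr; exact h.fderiv_norm_le _ (m₁ ht))
    have n3 : ‖G (c₂ t) - G (c₁ t) - fderiv ℝ G (c₁ t) (c₂ t - c₁ t)‖ ≤ N * D * D :=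
      (h.taylor (m₁ ht) (m₂ ht)).trans (by gcongr)
    rw [e]
    calc _ ≤ N * D * D * 1 * 1 + N * D * 1 * D + N * D * D * 1 + N * D * D := by
          refine norm_add_le_of_le (norm_add_le_of_le (norm_add_le_of_le ?_ ?_) ?_) ?_ <;>
          · refine (ContinuousLinearMap.le_opNorm₂ _ _ _).trans ?_
            gcongr
      _ = 4 * N * D * D := by ring
  have := norm_image_sub_le_of_hasDerivWithinAt_unitInterval hd hb z o
  rw [h0] at this
  simp only [one_mul, zero_mul, sub_self, map_zero, mul_zero, sub_zero] at this
  refine this.trans ?_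
  -- `4 * (4 / 3)² = 64 / 9 ≤ 8`.
  calc 4 * N * D * D ≤ 4 * N * (4 / 3 * ‖c₂ 1 - c₁ 1‖) * (4 / 3 * ‖c₂ 1 - c₁ 1‖) := by gcongr
    _ ≤ 8 * N * ‖c₂ 1 - c₁ 1‖ ^ 2 := by nlinarith [mul_nonneg hN (sq_nonneg ‖c₂ 1 - c₁ 1‖)]

theorem apply_ne_zero (h : LorentzBall G Γ T x₀ a K N) {x v : E} (hx : x ∈ closedBall x₀ a)
    (hv : v ≠ 0) (hvv : G x v v ≤ 0) : G x v T ≠ 0 :=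
  fun h0 => absurd (h.spacelike x hx v hv h0) (not_lt.2 hvv)

/-- Geodesics in the small ball have velocity at most `a`. -/
theorem velocity_le (h : LorentzBall G Γ T x₀ a K N) {c v : ℝ → E} (hc : CoordGeodesic Γ c v)
    (hmem : MapsTo c (Icc 0 1) (ball x₀ (a / 16))) : ∀ t ∈ Icc (0 : ℝ) 1, ‖v t‖ ≤ a :=
  fun t ht => by
    have := h.norm_velocity_le (ρ := a / 16) (by linarith [h.pos]) hc
      (hmem.mono_right ball_subset_closedBall) ht
    linarith [h.pos]

/-- A geodesic which is initially causal and future-directed remains so. -/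
theorem future_of_initial (h : LorentzBall G Γ T x₀ a K N) {c v : ℝ → E}
    (hc : CoordGeodesic Γ c v) (hmem : MapsTo c (Icc 0 1) (ball x₀ (a / 16)))
    (h0 : G (c 0) (v 0) (v 0) ≤ 0) (hT : G (c 0) (v 0) T < 0) {t : ℝ}
    (ht : t ∈ Icc (0 : ℝ) 1) : G (c t) (v t) T < 0 := by
  have z : (0 : ℝ) ∈ Icc (0 : ℝ) 1 := left_mem_Icc.2 zero_le_one
  have hmem' := hmem.mono_right h.ball_subset
  have hv : ∀ s ∈ Icc (0 : ℝ) 1, v s ≠ 0 := fun s hs hs0 => by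
    rw [h.velocity_eq_zero hc hmem' (h.velocity_le hc hmem) hs hs0 z] at hT
    simp at hT
  by_contra! ht'
  have hcont : ContinuousOn (fun s => G (c s) (v s) T) (Icc 0 t) :=
    (((h.continuousOn.comp hc.continuousOn hmem').clm_apply hc.continuousOn_velocity).clm_apply
      continuousOn_const).mono (Icc_subset_Icc le_rfl ht.2)
  -- At a zero the velocity would be a nonzero causal vector orthogonal to `T`.
  obtain ⟨s, hs, hs0⟩ := intermediate_value_Icc ht.1 hcont ⟨hT.le, ht'⟩
  have hs : s ∈ Icc (0 : ℝ) 1 := ⟨hs.1, hs.2.trans ht.2⟩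
  exact h.apply_ne_zero (hmem' hs) (hv s hs) (by rw [h.speed_eq hc hmem' hs]; exact h0) hs0

/-- Two geodesics in the small ball with the same end points agree. -/
theorem eqOn_of_endpoints (h : LorentzBall G Γ T x₀ a K N) {c₁ v₁ c₂ v₂ : ℝ → E}
    (h₁ : CoordGeodesic Γ c₁ v₁) (h₂ : CoordGeodesic Γ c₂ v₂)
    (m₁ : MapsTo c₁ (Icc 0 1) (ball x₀ (a / 16))) (m₂ : MapsTo c₂ (Icc 0 1) (ball x₀ (a / 16)))
    (h0 : c₁ 0 = c₂ 0) (h1 : c₁ 1 = c₂ 1) : EqOn c₁ c₂ (Icc 0 1) ∧ EqOn v₁ v₂ (Icc 0 1) := by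
  obtain ⟨D, hv, hc, -, hD, -⟩ := h.comparison h₁ h₂ (m₁.mono_right h.ball_subset)
    (m₂.mono_right h.ball_subset) (h.velocity_le h₁ m₁) (h.velocity_le h₂ m₂) h0
  rw [h1, sub_self, norm_zero, mul_zero] at hD
  exact ⟨fun t ht => sub_eq_zero.1 (norm_le_zero_iff.1 ((hc t ht).trans hD)),
    fun t ht => sub_eq_zero.1 (norm_le_zero_iff.1 ((hv t ht).trans hD))⟩

end LorentzBall

/-- A choice of geodesics from `p` to all points of `U`. -/
structure RadialGeodesics (Γ : E → E →L[ℝ] E →L[ℝ] E) (U : Set E) (p : E) (c v : E → ℝ → E) :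
    Prop where
  geodesic : ∀ q ∈ U, CoordGeodesic Γ (c q) (v q)
  left : ∀ q ∈ U, c q 0 = p
  right : ∀ q ∈ U, c q 1 = q
  mapsTo : ∀ q ∈ U, MapsTo (c q) (Icc 0 1) U

/-! ### Radial geodesics, the Gauss lemma, and timelike curves near causal ones. -/

namespace LorentzBall

variable {G : E → E →L[ℝ] E →L[ℝ] ℝ} {Γ : E → E →L[ℝ] E →L[ℝ] E} {T x₀ : E} {a K N : ℝ}

theorem exists_radialGeodesics [CompleteSpace E] (h : LorentzBall G Γ T x₀ a K N) {p : E}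
    (hp : p ∈ ball x₀ (a / 16)) :
    ∃ c v : E → ℝ → E, RadialGeodesics Γ (ball x₀ (a / 16)) p c v := by
  have : ∀ q, ∃ c v : ℝ → E, q ∈ ball x₀ (a / 16) → CoordGeodesic Γ c v ∧ c 0 = p ∧ c 1 = q ∧
      MapsTo c (Icc 0 1) (ball x₀ (a / 16)) := fun q => by
    by_cases hq : q ∈ ball x₀ (a / 16)
    · obtain ⟨c, v, hcv⟩ := h.exists_geodesic hp hq
      exact ⟨c, v, fun _ => hcv⟩
    · exact ⟨fun _ => 0, fun _ => 0, fun h' => absurd h' hq⟩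
  choose c v hcv using this
  exact ⟨c, v, fun q hq => (hcv q hq).1, fun q hq => (hcv q hq).2.1,
    fun q hq => (hcv q hq).2.2.1, fun q hq => (hcv q hq).2.2.2⟩

variable {p : E} {c v : E → ℝ → E}

/-- `comparison` bounds the difference of initial velocities by `4 / 3` of the distance of the end
points, so the inverse exponential map is Lipschitz. -/
theorem continuousOn_initialVelocity (h : LorentzBall G Γ T x₀ a K N)
    (hR : RadialGeodesics Γ (ball x₀ (a / 16)) p c v) :
    ContinuousOn (fun q => v q 0) (ball x₀ (a / 16)) := by
  have : LipschitzOnWith (4 / 3) (fun q => v q 0) (ball x₀ (a / 16)) := by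
    refine LipschitzOnWith.of_dist_le_mul fun q hq q' hq' => ?_
    obtain ⟨D, hv, -, -, hD, -⟩ := h.comparison (hR.geodesic q hq) (hR.geodesic q' hq')
      ((hR.mapsTo q hq).mono_right h.ball_subset) ((hR.mapsTo q' hq').mono_right h.ball_subset)
      (h.velocity_le (hR.geodesic q hq) (hR.mapsTo q hq))
      (h.velocity_le (hR.geodesic q' hq') (hR.mapsTo q' hq'))
      ((hR.left q hq).trans (hR.left q' hq').symm)
    rw [hR.right q hq, hR.right q' hq'] at hD
    rw [dist_eq_norm, dist_eq_norm]
    push_cast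
    exact (hv 0 (left_mem_Icc.2 zero_le_one)).trans hD
  exact this.continuousOn

/-- The derivative at `q` of the energy of the geodesic from `p`: a form of the Gauss lemma. -/
theorem hasFDerivAt_energy (h : LorentzBall G Γ T x₀ a K N)
    (hR : RadialGeodesics Γ (ball x₀ (a / 16)) p c v) {q : E} (hq : q ∈ ball x₀ (a / 16)) :
    HasFDerivAt (fun q => G p (v q 0) (v q 0)) ((2 : ℝ) • G q (v q 1)) q := by
  refine hasFDerivAt_of_norm_sub_le_sq (C := 8 * N) (isOpen_ball.mem_nhds hq) fun q' hq' => ?_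
  have := h.first_variation (hR.geodesic q hq) (hR.geodesic q' hq')
      ((hR.mapsTo q hq).mono_right h.ball_subset) ((hR.mapsTo q' hq').mono_right h.ball_subset)
      (h.velocity_le (hR.geodesic q hq) (hR.mapsTo q hq))
      (h.velocity_le (hR.geodesic q' hq') (hR.mapsTo q' hq'))
      ((hR.left q hq).trans (hR.left q' hq').symm)
  rwa [hR.right q hq, hR.right q' hq', hR.left q hq, hR.left q' hq'] at this

/-- Comparison with the constant geodesic at `p` bounds the speed by `4 / 3 * ‖q - p‖`. The
acceleration is then quadratic in `‖q - p‖`, with `16 / 9 ≤ 2`, and it controls the deviation of the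
initial velocity from the chord. -/
theorem norm_initialVelocity_sub_le (h : LorentzBall G Γ T x₀ a K N)
    (hR : RadialGeodesics Γ (ball x₀ (a / 16)) p c v) (hp : p ∈ ball x₀ (a / 16)) {q : E}
    (hq : q ∈ ball x₀ (a / 16)) : ‖v q 0 - (q - p)‖ ≤ 2 * K * ‖q - p‖ ^ 2 := by
  have hg := hR.geodesic q hq
  have hm := (hR.mapsTo q hq).mono_right h.ball_subset
  obtain ⟨D, hv, -, -, hD, -⟩ := h.comparison hg (CoordGeodesic.const Γ p) hm
    (fun _ _ => h.ball_subset hp) (h.velocity_le hg (hR.mapsTo q hq))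
    (fun _ _ => by simpa using h.pos.le) (hR.left q hq)
  rw [hR.right q hq] at hD
  have hK := h.nonneg
  have hacc : ∀ s ∈ Icc (0 : ℝ) 1,
      ‖-(Γ (c q s) (v q s) (v q s))‖ ≤ 2 * K * ‖q - p‖ ^ 2 := fun s hs => by
    rw [norm_neg]
    refine (h.norm_apply_le (hm hs) _ _).trans ?_
    have hs' := (hv s hs).trans hD
    rw [sub_zero] at hs'
    calc _ ≤ K * (4 / 3 * ‖q - p‖) * (4 / 3 * ‖q - p‖) := by gcongr
      _ ≤ _ := by nlinarith [mul_nonneg hK (sq_nonneg ‖q - p‖)]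
  have := norm_image_sub_sub_deriv_le hg.deriv (t := 0) fun s hs =>
    norm_image_sub_le_of_hasDerivWithinAt_unitInterval hg.deriv₂ hacc
      (left_mem_Icc.2 zero_le_one) hs
  rwa [hR.right q hq, hR.left q hq, norm_sub_rev] at this

theorem initialVelocity_self (h : LorentzBall G Γ T x₀ a K N)
    (hR : RadialGeodesics Γ (ball x₀ (a / 16)) p c v) (hp : p ∈ ball x₀ (a / 16)) :
    v p 0 = 0 := by
  have := h.norm_initialVelocity_sub_le hR hp hp
  simpa using this

theorem hasFDerivAt_initialVelocity (h : LorentzBall G Γ T x₀ a K N)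
    (hR : RadialGeodesics Γ (ball x₀ (a / 16)) p c v) (hp : p ∈ ball x₀ (a / 16)) :
    HasFDerivAt (fun q => v q 0) (ContinuousLinearMap.id ℝ E) p := by
  refine hasFDerivAt_of_norm_sub_le_sq (C := 2 * K) (isOpen_ball.mem_nhds hp) fun q hq => ?_
  rw [h.initialVelocity_self hR hp, sub_zero]
  exact h.norm_initialVelocity_sub_le hR hp hq

/-- If `q` is reached from `p` by a future-directed timelike curve, then the geodesic from `p` to
`q` is initially timelike and future-pointing. -/
theorem initialVelocity_timelike (h : LorentzBall G Γ T x₀ a K N)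
    (hR : RadialGeodesics Γ (ball x₀ (a / 16)) p c v) {γ γ' : ℝ → E}
    (hγ : ∀ t ∈ Icc (0 : ℝ) 1, HasDerivWithinAt γ (γ' t) (Icc 0 1) t)
    (hmem : MapsTo γ (Icc 0 1) (ball x₀ (a / 16))) (h0 : γ 0 = p)
    (htl : ∀ t ∈ Icc (0 : ℝ) 1, G (γ t) (γ' t) (γ' t) < 0)
    (hfut : ∀ t ∈ Icc (0 : ℝ) 1, G (γ t) (γ' t) T < 0) :
    G p (v (γ 1) 0) (v (γ 1) 0) < 0 ∧ G p (v (γ 1) 0) T < 0 := by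
  have z : (0 : ℝ) ∈ Icc (0 : ℝ) 1 := left_mem_Icc.2 zero_le_one
  have hp : p ∈ ball x₀ (a / 16) := h0 ▸ hmem z
  set w : ℝ → E := fun t => v (γ t) 0 with hw
  have hw0 : w 0 = 0 := by rw [hw]; simp only [h0]; exact h.initialVelocity_self hR hp
  have hwc : ContinuousOn w (Icc 0 1) :=
    (h.continuousOn_initialVelocity hR).comp (fun t ht => (hγ t ht).continuousWithinAt) hmem
  have hwd : HasDerivWithinAt w (γ' 0) (Icc 0 1) 0 := by
    have h1 := h.hasFDerivAt_initialVelocity hR hp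
    rw [← h0] at h1
    exact h1.comp_hasDerivWithinAt 0 (hγ 0 z)
  have hslope : Filter.Tendsto (slope w 0) (𝓝[>] 0) (𝓝 (γ' 0)) := by
    rw [hasDerivWithinAt_iff_tendsto_slope] at hwd
    refine hwd.mono_left ?_
    rw [← nhdsWithin_Ioo_eq_nhdsGT (zero_lt_one' ℝ)]
    exact nhdsWithin_mono _ fun t ht => ⟨Ioo_subset_Icc_self ht, ht.1.ne'⟩
  -- The energy vanishes at `t = 0`, so the argument has to start slightly later. The quotient `w t
  -- / t` tends to `γ' 0`, which lies in the open future cone, and membership in the cone is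
  -- invariant under positive scaling.
  have ev : ∀ᶠ t in 𝓝[>] (0 : ℝ), G p (w t) (w t) < 0 ∧ G p (w t) T < 0 := by
    have c1 : Continuous fun u => G p u u := by fun_prop
    have c2 : Continuous fun u => G p u T := by fun_prop
    have t1 := ((c1.tendsto _).comp hslope).eventually_lt_const (h0 ▸ htl 0 z)
    have t2 := ((c2.tendsto _).comp hslope).eventually_lt_const (h0 ▸ hfut 0 z)
    filter_upwards [t1, t2, self_mem_nhdsWithin] with t e1 e2 ht
    have ht : 0 < t⁻¹ := inv_pos.2 ht
    simp only [Function.comp, slope_def_module, hw0, sub_zero, map_smul, smul_apply,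
      smul_eq_mul] at e1 e2
    constructor <;> by_contra! hcon
    · exact absurd e1 (not_lt.2 (by positivity))
    · exact absurd e2 (not_lt.2 (by positivity))
  obtain ⟨ε, hεev, hε0, hε1⟩ :=
    (ev.and (Ioo_mem_nhdsGT (zero_lt_one' ℝ))).exists
  set f : ℝ → ℝ := fun t => G p (w t) (w t) with hf
  set k : ℝ → ℝ := fun t => G p (w t) T with hk
  have hfc : ContinuousOn f (Icc 0 1) := (continuousOn_const.clm_apply hwc).clm_apply hwc
  have hkc : ContinuousOn k (Icc 0 1) := (continuousOn_const.clm_apply hwc).clm_apply continuousOn_const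
  by_contra hbad
  have hsub : Icc ε 1 ⊆ Icc (0 : ℝ) 1 := Icc_subset_Icc hε0.le le_rfl
  have hcl : IsClosed {t ∈ Icc ε 1 | 0 ≤ max (f t) (k t)} :=
    ((hfc.mono hsub).sup (hkc.mono hsub)).preimage_isClosed_of_isClosed isClosed_Icc
      (isClosed_Ici (a := (0 : ℝ)))
  have hne : {t ∈ Icc ε 1 | 0 ≤ max (f t) (k t)}.Nonempty := by
    refine ⟨1, ⟨hε1.le, le_rfl⟩, ?_⟩
    by_contra! hlt
    exact hbad (max_lt_iff.1 hlt)
  -- `τ` is the first time after `ε` at which `w` is outside the open future timelike cone of `p`.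
  obtain ⟨τ, ⟨hτ, hτbad⟩, hτmin⟩ :=
    (isCompact_Icc.of_isClosed_subset hcl (sep_subset _ _)).exists_isLeast hne
  have hgood : ∀ t ∈ Ico ε τ, f t < 0 ∧ k t < 0 := fun t ht => by
    by_contra hcon
    refine absurd (hτmin ⟨⟨ht.1, ht.2.le.trans hτ.2⟩, ?_⟩) (not_le.2 ht.2)
    by_contra! hlt
    exact hcon (max_lt_iff.1 hlt)
  have hετ : ε < τ := by
    refine lt_of_le_of_ne hτ.1 fun heq => ?_
    rw [← heq] at hτbad
    exact absurd hτbad (not_le.2 (max_lt hεev.1 hεev.2))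
  have hsub' : Icc ε τ ⊆ Icc (0 : ℝ) 1 := (Icc_subset_Icc le_rfl hτ.2).trans hsub
  -- By the Gauss lemma the derivative is twice the product of the radial velocity at `γ t` with `γ'
  -- t`. Before `τ` both are timelike and future-pointing, since the radial geodesic keeps its
  -- causal type, so the product is negative.
  have hanti : AntitoneOn f (Icc ε τ) := by
    refine antitoneOn_of_hasDerivWithinAt_nonpos (f' := fun t => 2 * G (γ t) (v (γ t) 1) (γ' t))
      (convex_Icc ε τ) (hfc.mono hsub') (fun t ht => ?_) fun t ht => ?_
    · have ht' := hsub' (interior_subset ht)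
      have := (h.hasFDerivAt_energy hR (hmem ht')).comp_hasDerivWithinAt t (hγ t ht')
      exact this.mono (interior_subset.trans hsub')
    · have ht' := hsub' (interior_subset ht)
      rw [interior_Icc] at ht
      obtain ⟨g1, g2⟩ := hgood t ⟨ht.1.le, ht.2⟩
      have hq := hmem ht'
      have o : (1 : ℝ) ∈ Icc (0 : ℝ) 1 := right_mem_Icc.2 zero_le_one
      have s1 := h.speed_eq (hR.geodesic _ hq) ((hR.mapsTo _ hq).mono_right h.ball_subset) o
      have s2 := h.future_of_initial (hR.geodesic _ hq) (hR.mapsTo _ hq)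
        (by rw [hR.left _ hq]; exact g1.le) (by rw [hR.left _ hq]; exact g2) o
      rw [hR.right _ hq, hR.left _ hq] at s1
      rw [hR.right _ hq] at s2
      have := lorentzForm_apply_neg (h.symm (γ t)) (h.spacelike _ (h.ball_subset hq))
        (s1.trans_lt g1) s2 (htl t ht').le (hfut t ht')
      linarith
  have hfτ : f τ < 0 :=
    (hanti ⟨le_rfl, hετ.le⟩ ⟨hετ.le, le_rfl⟩ hετ.le).trans_lt hεev.1
  have hkτ : k τ ≤ 0 := by
    have hlim : Filter.Tendsto k (𝓝[Ico ε τ] τ) (𝓝 (k τ)) :=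
      (hkc.mono hsub' τ ⟨hετ.le, le_rfl⟩).mono_left (nhdsWithin_mono _ Ico_subset_Icc_self)
    have : (𝓝[Ico ε τ] τ).NeBot := by
      rw [nhdsWithin_Ico_eq_nhdsLT hετ]; infer_instance
    exact le_of_tendsto hlim (Filter.mem_of_superset self_mem_nhdsWithin fun t ht =>
      (hgood t ht).2.le)
  have hwτ : w τ ≠ 0 := fun h0 => by simp [hf, h0] at hfτ
  -- The limit gives only `≤`, but `w τ` is nonzero and causal, hence not orthogonal to `T`; so `w
  -- τ` is still in the open cone, against the choice of `τ`.
  have hkτ' : k τ < 0 :=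
    lt_of_le_of_ne hkτ (h.apply_ne_zero (h.ball_subset hp) hwτ hfτ.le)
  exact absurd hτbad (not_le.2 (max_lt hfτ hkτ'))

/-- Causal vectors are uniformly transversal to the hyperplanes orthogonal to `T`. -/
theorem exists_pos_mul_norm_le [FiniteDimensional ℝ E] (h : LorentzBall G Γ T x₀ a K N) :
    ∃ κ > 0, ∀ x ∈ closedBall x₀ a, ∀ v, G x v v ≤ 0 → G x v T ≤ 0 → κ * ‖v‖ ≤ -G x v T := by
  have : ProperSpace E := FiniteDimensional.proper ℝ E
  have hc1 : ContinuousOn (fun z : E × E => G z.1) (closedBall x₀ a ×ˢ sphere (0 : E) 1) :=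
    h.continuousOn.comp continuousOn_fst fun z hz => hz.1
  have hc2 : ContinuousOn (fun z : E × E => G z.1 z.2 z.2) (closedBall x₀ a ×ˢ sphere (0 : E) 1) :=
    (hc1.clm_apply continuousOn_snd).clm_apply continuousOn_snd
  have hc3 : ContinuousOn (fun z : E × E => G z.1 z.2 T) (closedBall x₀ a ×ˢ sphere (0 : E) 1) :=
    (hc1.clm_apply continuousOn_snd).clm_apply continuousOn_const
  have hcpt : IsCompact (closedBall x₀ a ×ˢ sphere (0 : E) 1) :=
    (isCompact_closedBall x₀ a).prod (isCompact_sphere 0 1)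
  set S := {z ∈ closedBall x₀ a ×ˢ sphere (0 : E) 1 | max (G z.1 z.2 z.2) (G z.1 z.2 T) ≤ 0}
    with hS
  have hScl : IsClosed S :=
    (hc2.sup hc3).preimage_isClosed_of_isClosed hcpt.isClosed (isClosed_Iic (a := (0 : ℝ)))
  have hScpt : IsCompact S := hcpt.of_isClosed_subset hScl (sep_subset _ _)
  -- By homogeneity unit vectors suffice. These form a compact set on which `-G x v T` is positive,
  -- because a nonzero causal vector is never orthogonal to `T`.
  obtain ⟨κ, hκ, hκS⟩ : ∃ κ > 0, ∀ z ∈ S, κ ≤ -G z.1 z.2 T := by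
    rcases S.eq_empty_or_nonempty with he | hne
    · exact ⟨1, one_pos, by simp [he]⟩
    · obtain ⟨z₀, hz₀, hmin⟩ := hScpt.exists_isMinOn hne (hc3.mono (sep_subset _ _)).neg
      obtain ⟨hle1, hle2⟩ := max_le_iff.1 hz₀.2
      refine ⟨-G z₀.1 z₀.2 T, ?_, fun z hz => hmin hz⟩
      have hne0 : z₀.2 ≠ 0 := ne_zero_of_mem_unit_sphere ⟨z₀.2, hz₀.1.2⟩
      exact neg_pos.2 (lt_of_le_of_ne hle2 (h.apply_ne_zero hz₀.1.1 hne0 hle1))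
  refine ⟨κ, hκ, fun x hx v h1 h2 => ?_⟩
  rcases eq_or_ne v 0 with rfl | hv
  · simp
  have hn : 0 < ‖v‖ := norm_pos_iff.2 hv
  have hi : 0 < ‖v‖⁻¹ := inv_pos.2 hn
  have := hκS (x, ‖v‖⁻¹ • v) ⟨⟨hx, by simp [norm_smul, hn.ne']⟩, by
    simp only [map_smul, smul_apply, smul_eq_mul]
    exact max_le (mul_nonpos_of_nonneg_of_nonpos hi.le (mul_nonpos_of_nonneg_of_nonpos hi.le h1))
      (mul_nonpos_of_nonneg_of_nonpos hi.le h2)⟩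
  simp only [map_smul, smul_apply, smul_eq_mul] at this
  rw [inv_mul_eq_div, ← neg_div, le_div_iff₀ hn] at this
  exact this

/-- A future-directed causal curve becomes timelike when it is pushed into the future by a
suitable multiple of `T`. -/
theorem exists_timelike_perturbation [FiniteDimensional ℝ E] (h : LorentzBall G Γ T x₀ a K N)
    {γ γ' : ℝ → E} (hγ : ContinuousOn γ (Icc 0 1)) (hγ' : ContinuousOn γ' (Icc 0 1))
    (hmem : MapsTo γ (Icc 0 1) (ball x₀ (a / 16)))
    (hcau : ∀ t ∈ Icc (0 : ℝ) 1, G (γ t) (γ' t) (γ' t) ≤ 0)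
    (hfut : ∀ t ∈ Icc (0 : ℝ) 1, γ' t ≠ 0 → G (γ t) (γ' t) T < 0) :
    ∃ l > 0, ∀ᶠ ε in 𝓝[>] (0 : ℝ), ∀ t ∈ Icc (0 : ℝ) 1,
      γ t + (ε * (Real.exp (l * t) - 1)) • T ∈ ball x₀ (a / 16) ∧
      G (γ t + (ε * (Real.exp (l * t) - 1)) • T) (γ' t + (ε * (l * Real.exp (l * t))) • T)
        (γ' t + (ε * (l * Real.exp (l * t))) • T) < 0 ∧
      G (γ t + (ε * (Real.exp (l * t) - 1)) • T) (γ' t + (ε * (l * Real.exp (l * t))) • T) T < 0 := by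
  obtain ⟨κ, hκ, hκT⟩ := h.exists_pos_mul_norm_le
  have hN := h.bound_nonneg
  obtain ⟨S, hS⟩ := isCompact_Icc.exists_bound_of_continuousOn hγ'
  have hS0 : 0 ≤ S := (norm_nonneg _).trans (hS 0 (left_mem_Icc.2 zero_le_one))
  obtain ⟨δ, hδ, hδball⟩ : ∃ δ > 0, ∀ t ∈ Icc (0 : ℝ) 1, ∀ y, ‖y‖ < δ →
      γ t + y ∈ ball x₀ (a / 16) := by
    obtain ⟨δ, hδ, hδs⟩ := (isCompact_Icc.image_of_continuousOn hγ).exists_thickening_subset_open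
      isOpen_ball (image_subset_iff.2 hmem)
    refine ⟨δ, hδ, fun t ht y hy => hδs (mem_thickening_iff.2 ⟨γ t, mem_image_of_mem γ ht, ?_⟩)⟩
    simpa [dist_eq_norm] using hy
  -- Moving the base point by `ε (exp (l t) - 1) T` costs at most `N ε exp (l t) ‖T‖ S ‖u‖` in the
  -- square of `u = γ' t`; adding `b T`, with `b = ε l exp (l t)`, gains `b κ ‖u‖` from the cross
  -- term. This `l` makes `l * κ` dominate `N * ‖T‖ * S`, so the gain wins for every `ε`.
  set l := N * ‖T‖ * S / κ + 1 with hl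
  have hl0 : 0 < l := by positivity
  refine ⟨l, hl0, ?_⟩
  set R := Real.exp l with hR
  have hR0 : 0 < R := Real.exp_pos l
  have ev1 : ∀ᶠ ε in 𝓝[>] (0 : ℝ), ε * R * ‖T‖ < δ := by
    have : Filter.Tendsto (fun ε : ℝ => ε * R * ‖T‖) (𝓝[>] 0) (𝓝 (0 * R * ‖T‖)) :=
      tendsto_nhdsWithin_of_tendsto_nhds (Continuous.tendsto (by fun_prop) 0)
    exact this.eventually_lt_const (by simpa using hδ)
  -- This keeps half of the transversality constant `κ` at the displaced base point.
  have ev2 : ∀ᶠ ε in 𝓝[>] (0 : ℝ), N * (ε * R * ‖T‖) * ‖T‖ < κ / 2 := by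
    have : Filter.Tendsto (fun ε : ℝ => N * (ε * R * ‖T‖) * ‖T‖) (𝓝[>] 0)
        (𝓝 (N * (0 * R * ‖T‖) * ‖T‖)) :=
      tendsto_nhdsWithin_of_tendsto_nhds (Continuous.tendsto (by fun_prop) 0)
    exact this.eventually_lt_const (by simpa using by positivity)
  filter_upwards [ev1, ev2, self_mem_nhdsWithin] with ε e1 e2 hε t ht
  have hε : 0 < ε := hε
  set e := Real.exp (l * t) with he
  have he0 : 0 < e := Real.exp_pos _
  have he1 : 1 ≤ e := Real.one_le_exp (mul_nonneg hl0.le ht.1)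
  have heR : e ≤ R := Real.exp_le_exp.2 (by nlinarith [ht.2])
  set x := γ t with hx
  set u := γ' t with hu
  set y := (ε * (e - 1)) • T with hy
  have hyn : ‖y‖ = ε * (e - 1) * ‖T‖ := by
    rw [hy, norm_smul, Real.norm_of_nonneg (mul_nonneg hε.le (by linarith))]
  have hyR : ‖y‖ ≤ ε * R * ‖T‖ := by
    rw [hyn]; gcongr; linarith
  have hxy : x + y ∈ ball x₀ (a / 16) := hδball t ht y (hyR.trans_lt e1)
  have hxB := h.ball_subset (hmem ht)
  have hxyB := h.ball_subset hxy
  have hlip : ‖G (x + y) - G x‖ ≤ N * ‖y‖ := by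
    have := (convex_closedBall x₀ a).norm_image_sub_le_of_norm_fderiv_le
      (fun z hz => h.differentiableAt z hz) h.fderiv_norm_le hxB hxyB
    rwa [← hx, add_sub_cancel_left] at this
  have huS : ‖u‖ ≤ S := hS t ht
  have huT : κ * ‖u‖ ≤ -G x u T := by
    rcases eq_or_ne u 0 with h0 | h0
    · simp [h0]
    · exact hκT x hxB u (hcau t ht) (hfut t ht h0).le
  have i1 : G (x + y) u u ≤ N * ‖y‖ * ‖u‖ * ‖u‖ := by
    have h1 : ‖(G (x + y) - G x) u u‖ ≤ N * ‖y‖ * ‖u‖ * ‖u‖ :=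
      (ContinuousLinearMap.le_opNorm₂ _ _ _).trans (by gcongr)
    have h2 := (abs_le.1 h1).2
    simp only [sub_apply] at h2
    linarith [hcau t ht]
  have i2 : G (x + y) u T ≤ -(κ / 2) * ‖u‖ := by
    have h1 : ‖(G (x + y) - G x) u T‖ ≤ N * ‖y‖ * ‖u‖ * ‖T‖ :=
      (ContinuousLinearMap.le_opNorm₂ _ _ _).trans (by gcongr)
    have h2 := (abs_le.1 h1).2
    simp only [sub_apply] at h2
    have h3 : N * ‖y‖ * ‖u‖ * ‖T‖ ≤ κ / 2 * ‖u‖ := by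
      have : N * ‖y‖ * ‖T‖ ≤ κ / 2 := by
        refine le_trans ?_ e2.le
        gcongr
      nlinarith [norm_nonneg u]
    linarith
  have i3 : G (x + y) T T < 0 := h.timelike _ hxyB
  set b := ε * (l * e) with hb
  have hb0 : 0 < b := by positivity
  refine ⟨hxy, ?_, ?_⟩
  · have i4 : N * ‖y‖ * ‖u‖ * ‖u‖ ≤ b * κ * ‖u‖ := by
      have h1 : N * ‖T‖ * S ≤ l * κ := by
        rw [hl, add_mul, div_mul_cancel₀ _ hκ.ne']; linarith
      have h2 : N * ‖y‖ * ‖u‖ ≤ b * κ := by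
        calc N * ‖y‖ * ‖u‖ ≤ N * (ε * (e - 1) * ‖T‖) * S := by rw [hyn]; gcongr
          _ = (N * ‖T‖ * S) * (ε * (e - 1)) := by ring
          _ ≤ (l * κ) * (ε * e) := by
              refine mul_le_mul h1 ?_ (mul_nonneg hε.le (by linarith)) (by positivity)
              gcongr
              linarith
          _ = b * κ := by rw [hb]; ring
      exact mul_le_mul_of_nonneg_right h2 (norm_nonneg u)
    -- The cross term, counted twice, compensates `i4`. Strict negativity comes from `b² G(T, T)`,
    -- which also covers points where `u = 0`.
    have i5 : b * G (x + y) u T ≤ b * (-(κ / 2) * ‖u‖) := mul_le_mul_of_nonneg_left i2 hb0.le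
    have i6 : b * b * G (x + y) T T < 0 := mul_neg_of_pos_of_neg (by positivity) i3
    simp only [map_add, map_smul, add_apply, smul_apply, smul_eq_mul]
    rw [h.symm (x + y) T u]
    linarith
  · simp only [map_add, map_smul, add_apply, smul_apply, smul_eq_mul]
    have := mul_neg_of_pos_of_neg hb0 i3
    have : 0 ≤ κ / 2 * ‖u‖ := by positivity
    linarith

end LorentzBall

end LocalCausality

/-! ### Consequences of the signature -/

section Signature

variable {n : ℕ} {W : Type*} [AddCommGroup W] [Module ℝ W] [TopologicalSpace W]
  {β : W →L[ℝ] W →L[ℝ] ℝ} {b : Module.Basis (Fin (n + 1)) ℝ W}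

theorem lorentzForm_apply_eq_sum
    (hb : ∀ i j, β (b i) (b j) = if i = j then (if i = 0 then -1 else 1) else 0) (v w : W) :
    β v w = -(b.repr v 0 * b.repr w 0) + ∑ i : Fin n, b.repr v i.succ * b.repr w i.succ := by
  have : ∀ v w, β v w = ∑ i, ∑ j, b.repr v i * (b.repr w j * β (b i) (b j)) := fun v w => by
    conv_lhs => rw [← b.sum_repr v, ← b.sum_repr w]
    simp only [map_sum, map_smul, sum_apply, smul_apply, smul_eq_mul]
    simp only [Finset.mul_sum]
    rw [Finset.sum_comm]
    refine Finset.sum_congr rfl fun i _ => Finset.sum_congr rfl fun j _ => ?_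
    ring
  rw [this]
  simp only [hb, mul_ite, mul_zero, Finset.sum_ite_eq, Finset.mem_univ, if_true]
  rw [Fin.sum_univ_succ]
  simp [Fin.succ_ne_zero]

/-- Orthogonality equates `v₀ T₀` with the spatial product of `v` and `T`, and the spatial square of
`T` is less than `T₀²`. Cauchy-Schwarz then gives `v₀² < A`, where `A` is the spatial square of `v`,
unless `A = 0`, which forces `v = 0`. -/
theorem lorentzForm_pos_of_orthogonal
    (hb : ∀ i j, β (b i) (b j) = if i = j then (if i = 0 then -1 else 1) else 0) {T : W}
    (hT : β T T < 0) {v : W} (hv : v ≠ 0) (hvT : β v T = 0) : 0 < β v v := by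
  rw [lorentzForm_apply_eq_sum hb] at *
  simp only [← sq] at *
  have hcs := Finset.sum_mul_sq_le_sq_mul_sq Finset.univ (fun i : Fin n => b.repr v i.succ)
    (fun i : Fin n => b.repr T i.succ)
  set A := ∑ i : Fin n, b.repr v i.succ ^ 2
  set B := ∑ i : Fin n, b.repr T i.succ ^ 2
  set C := ∑ i : Fin n, b.repr v i.succ * b.repr T i.succ
  have hA0 : 0 ≤ A := Finset.sum_nonneg fun i _ => sq_nonneg _
  have hB0 : 0 ≤ B := Finset.sum_nonneg fun i _ => sq_nonneg _
  have hC : C = b.repr v 0 * b.repr T 0 := by linarith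
  have hT0 : 0 < b.repr T 0 ^ 2 := by linarith
  rw [hC, mul_pow] at hcs
  rcases hA0.eq_or_lt with hA | hA
  · exfalso
    apply hv
    have h0 : b.repr v 0 = 0 := by
      rw [← hA, zero_mul] at hcs
      have := le_antisymm hcs (by positivity)
      rcases mul_eq_zero.1 this with h | h
      · exact pow_eq_zero_iff two_ne_zero |>.1 h
      · exact absurd h hT0.ne'
    have h1 := (Finset.sum_eq_zero_iff_of_nonneg fun (i : Fin n) _ =>
      sq_nonneg (b.repr v i.succ)).1 hA.symm
    refine b.repr.map_eq_zero_iff.1 (Finsupp.ext fun i => ?_)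
    refine Fin.cases h0 (fun j => ?_) i
    exact pow_eq_zero_iff two_ne_zero |>.1 (h1 j (Finset.mem_univ j))
  · have : b.repr v 0 ^ 2 < A := by nlinarith
    linarith

theorem lorentzForm_eq_zero
    (hb : ∀ i j, β (b i) (b j) = if i = j then (if i = 0 then -1 else 1) else 0) {v : W}
    (hv : ∀ w, β v w = 0) : v = 0 := by
  refine b.repr.map_eq_zero_iff.1 (Finsupp.ext fun i => ?_)
  have h := hv (b i)
  rw [lorentzForm_apply_eq_sum hb] at h
  revert h
  refine Fin.cases ?_ (fun j => ?_) i
  · simp [Fin.succ_ne_zero, eq_comm]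
  · simp [Finsupp.single_apply, Fin.succ_ne_zero]

end Signature

/-! ### Levi-Civita connection coefficients of a form on a vector space -/

section LeviCivita

variable {E : Type*} [NormedAddCommGroup E] [NormedSpace ℝ E]

theorem isInvertible_of_injective_bilinear [FiniteDimensional ℝ E] {B : E →L[ℝ] E →L[ℝ] ℝ}
    (hB : Function.Injective B) : B.IsInvertible := by
  have hrank : Module.finrank ℝ E = Module.finrank ℝ (E →L[ℝ] ℝ) := by
    rw [← (LinearMap.toContinuousLinearMap (𝕜 := ℝ) (E := E) (F' := ℝ)).finrank_eq]
    exact (Subspace.dual_finrank_eq (K := ℝ) (V := E)).symm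
  let e := (LinearEquiv.ofInjectiveOfFinrankEq (B : E →ₗ[ℝ] (E →L[ℝ] ℝ)) hB
    hrank).toContinuousLinearEquiv
  exact ⟨e, by ext v w; rfl⟩

/-- The coefficients of the Levi-Civita connection of the nondegenerate symmetric form `G`. -/
noncomputable def leviCivita (G : E → E →L[ℝ] E →L[ℝ] ℝ) (y : E) : E →L[ℝ] E →L[ℝ] E :=
  let dg := fderiv ℝ G y
  (ContinuousLinearMap.compL ℝ E (E →L[ℝ] ℝ) E (G y).inverse).comp
    ((1 / 2 : ℝ) • (dg + dg.flip -
      ((ContinuousLinearMap.flipₗᵢ ℝ E E ℝ).toContinuousLinearEquiv :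
        (E →L[ℝ] E →L[ℝ] ℝ) →L[ℝ] (E →L[ℝ] E →L[ℝ] ℝ)).comp dg.flip))

/-- For `G = g.chartMetric x₀` the right-hand side is literally the body of `christoffel`, so the
two are interchangeable by definitional unfolding. -/
theorem leviCivita_apply (G : E → E →L[ℝ] E →L[ℝ] ℝ) (y v w : E) :
    leviCivita G y v w = (G y).inverse ((1 / 2 : ℝ) •
      (fderiv ℝ G y v w + fderiv ℝ G y w v - ((fderiv ℝ G y).flip v).flip w)) := rfl

theorem apply_leviCivita {G : E → E →L[ℝ] E →L[ℝ] ℝ} {y : E} (hy : (G y).IsInvertible)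
    (v z : E) : G y (leviCivita G y v v) z = fderiv ℝ G y v v z - 1 / 2 * fderiv ℝ G y z v v := by
  have h' : ∀ l, G y ((G y).inverse l) = l := fun l => DFunLike.congr_fun hy.self_comp_inverse l
  rw [leviCivita_apply, h']
  simp only [smul_apply, sub_apply, add_apply, ContinuousLinearMap.flip_apply, smul_eq_mul]
  ring

theorem contDiffAt_leviCivita [CompleteSpace E] {G : E → E →L[ℝ] E →L[ℝ] ℝ} {y : E}
    (hG : ContDiffAt ℝ ∞ G y) (hy : (G y).IsInvertible) : ContDiffAt ℝ ∞ (leviCivita G) y := by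
  have hd : ContDiffAt ℝ ∞ (fderiv ℝ G) y := hG.fderiv_right (by simp)
  have hinv : ContDiffAt ℝ ∞ (fun y => (G y).inverse) y := by
    obtain ⟨e, he⟩ := hy
    have := contDiffAt_map_inverse (n := ∞) e
    rw [he] at this
    exact this.comp y hG
  have hflip : ContDiffAt ℝ ∞ (fun y => (fderiv ℝ G y).flip) y :=
    (ContinuousLinearMap.flipₗᵢ ℝ E E (E →L[ℝ] ℝ)).contDiff.contDiffAt.comp y hd
  exact ((ContinuousLinearMap.contDiff _).contDiffAt.comp y hinv).clm_comp
    (((hd.add hflip).sub (contDiffAt_const.clm_comp hflip)).const_smul (1 / 2 : ℝ))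

end LeviCivita

/-! ### Smoothness of coordinate vector fields. -/

section ChartDerivative

variable {E H M : Type*} [NormedAddCommGroup E] [NormedSpace ℝ E] [TopologicalSpace H]
  [TopologicalSpace M] [ChartedSpace H M] {I : ModelWithCorners ℝ E H} [I.Boundaryless]
  [IsManifold I ∞ M]

theorem contMDiffOn_mfderiv_extChartAt_symm (x₀ : M) (v : E) :
    ContMDiffOn 𝓘(ℝ, E) (I.prod 𝓘(ℝ, E)) ∞
      (fun y => TotalSpace.mk' E (E := TangentSpace I (M := M))
        ((extChartAt I x₀).symm y) (mfderiv 𝓘(ℝ, E) I (extChartAt I x₀).symm y v))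
      (extChartAt I x₀).target := by
  have hopen := isOpen_extChartAt_target (I := I) x₀
  have h1 := (contMDiffOn_extChartAt_symm (I := I) (n := ∞) x₀).contMDiffOn_tangentMapWithin
    (m := ∞) (by simp) hopen.uniqueMDiffOn
  have h2 : ContMDiff 𝓘(ℝ, E) (𝓘(ℝ, E).prod 𝓘(ℝ, E)) ∞
      (fun y : E => (⟨y, v⟩ : TangentBundle 𝓘(ℝ, E) E)) := by
    rw [contMDiff_vectorSpace_iff_contDiff (V := fun _ => v)]
    exact contDiff_const
  refine (h1.comp h2.contMDiffOn (s := (extChartAt I x₀).target) fun y hy => hy).congr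
    fun y hy => ?_
  simp only [Function.comp, tangentMapWithin]
  rw [mfderivWithin_of_mem_nhds (hopen.mem_nhds hy)]

end ChartDerivative

namespace LorentzianMetric

variable {n : ℕ} {M : Type*} [TopologicalSpace M]
  [ChartedSpace (EuclideanSpace ℝ (Fin (n + 1))) M] [IsManifold (𝓡 (n + 1)) ∞ M]

local notation "𝔼" => EuclideanSpace ℝ (Fin (n + 1))

/-! ### The metric in a chart -/

/-- The derivative of the inverse of the chart around `x₀`. -/
noncomputable abbrev chartSymmDeriv (x₀ : M) (y : 𝔼) :
    𝔼 →L[ℝ] TangentSpace (𝓡 (n + 1)) ((extChartAt (𝓡 (n + 1)) x₀).symm y) :=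
  mfderiv 𝓘(ℝ, 𝔼) (𝓡 (n + 1)) (extChartAt (𝓡 (n + 1)) x₀).symm y

theorem chartMetric_apply (g : LorentzianMetric n M) (x₀ : M) (y v w : 𝔼) :
    g.chartMetric x₀ y v w = g.inner ((extChartAt (𝓡 (n + 1)) x₀).symm y)
      (chartSymmDeriv x₀ y v) (chartSymmDeriv x₀ y w) := rfl

theorem isInvertible_chartSymmDeriv (x₀ : M) {y : 𝔼}
    (hy : y ∈ (extChartAt (𝓡 (n + 1)) x₀).target) :
    (chartSymmDeriv x₀ y).IsInvertible := by
  have := isInvertible_mfderivWithin_extChartAt_symm (I := 𝓡 (n + 1)) hy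
  rwa [ModelWithCorners.range_eq_univ, mfderivWithin_univ] at this

theorem chartSymmDeriv_ne_zero (x₀ : M) {y : 𝔼} (hy : y ∈ (extChartAt (𝓡 (n + 1)) x₀).target)
    {v : 𝔼} (hv : v ≠ 0) : chartSymmDeriv x₀ y v ≠ 0 := fun h =>
  hv ((isInvertible_chartSymmDeriv x₀ hy).injective (h.trans (map_zero _).symm))

theorem chartMetric_symm (g : LorentzianMetric n M) (x₀ : M) (y v w : 𝔼) :
    g.chartMetric x₀ y v w = g.chartMetric x₀ y w v := by
  rw [chartMetric_apply, chartMetric_apply, g.symm]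

theorem inner_pos_of_orthogonal (g : LorentzianMetric n M) {x : M}
    {T v : TangentSpace (𝓡 (n + 1)) x} (hT : g.inner x T T < 0) (hv : v ≠ 0)
    (hvT : g.inner x v T = 0) : 0 < g.inner x v v := by
  obtain ⟨b, hb⟩ := g.signature x
  exact lorentzForm_pos_of_orthogonal hb hT hv hvT

theorem chartMetric_pos_of_orthogonal (g : LorentzianMetric n M) (x₀ : M) {y : 𝔼}
    (hy : y ∈ (extChartAt (𝓡 (n + 1)) x₀).target) {T v : 𝔼} (hT : g.chartMetric x₀ y T T < 0)
    (hv : v ≠ 0) (hvT : g.chartMetric x₀ y v T = 0) : 0 < g.chartMetric x₀ y v v := by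
  rw [chartMetric_apply] at *
  exact g.inner_pos_of_orthogonal hT (chartSymmDeriv_ne_zero x₀ hy hv) hvT

theorem isInvertible_chartMetric (g : LorentzianMetric n M) (x₀ : M) {y : 𝔼}
    (hy : y ∈ (extChartAt (𝓡 (n + 1)) x₀).target) : (g.chartMetric x₀ y).IsInvertible := by
  have hinj : Function.Injective (g.chartMetric x₀ y) := by
    refine (injective_iff_map_eq_zero _).2 fun v hv => ?_
    by_contra hne
    refine chartSymmDeriv_ne_zero x₀ hy hne ?_
    obtain ⟨b, hb⟩ := g.signature ((extChartAt (𝓡 (n + 1)) x₀).symm y)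
    refine lorentzForm_eq_zero hb fun w => ?_
    obtain ⟨w', rfl⟩ := (isInvertible_chartSymmDeriv x₀ hy).surjective w
    rw [← chartMetric_apply, hv]
    rfl
  exact isInvertible_of_injective_bilinear hinj

theorem contMDiffOn_chartSymmDeriv (x₀ : M) (v : 𝔼) :
    ContMDiffOn 𝓘(ℝ, 𝔼) ((𝓡 (n + 1)).prod 𝓘(ℝ, 𝔼)) ∞
      (fun y => TotalSpace.mk' 𝔼 (E := TangentSpace (𝓡 (n + 1)) (M := M))
        ((extChartAt (𝓡 (n + 1)) x₀).symm y) (chartSymmDeriv x₀ y v))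
      (extChartAt (𝓡 (n + 1)) x₀).target :=
  contMDiffOn_mfderiv_extChartAt_symm x₀ v

/-- Serves both for pairs of coordinate fields, giving smoothness of `chartMetric`, and for the
product of the time orientation with a coordinate field. -/
theorem contDiffOn_inner_of_contMDiffOn (g : LorentzianMetric n M) {s : Set 𝔼} {f : 𝔼 → M}
    {v w : ∀ y, TangentSpace (𝓡 (n + 1)) (f y)}
    (hv : ContMDiffOn 𝓘(ℝ, 𝔼) ((𝓡 (n + 1)).prod 𝓘(ℝ, 𝔼)) ∞
      (fun y => TotalSpace.mk' 𝔼 (E := TangentSpace (𝓡 (n + 1)) (M := M)) (f y) (v y)) s)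
    (hw : ContMDiffOn 𝓘(ℝ, 𝔼) ((𝓡 (n + 1)).prod 𝓘(ℝ, 𝔼)) ∞
      (fun y => TotalSpace.mk' 𝔼 (E := TangentSpace (𝓡 (n + 1)) (M := M)) (f y) (w y)) s) :
    ContDiffOn ℝ ∞ (fun y => g.inner (f y) (v y) (w y)) s := by
  rw [← contMDiffOn_iff_contDiffOn]
  have hf : ContMDiffOn 𝓘(ℝ, 𝔼) (𝓡 (n + 1)) ∞ f s := fun y hy =>
    (contMDiffWithinAt_totalSpace.1 (hv y hy)).1
  have := ContMDiffOn.clm_bundle_apply₂ (F₁ := 𝔼) (F₂ := 𝔼) (F₃ := ℝ)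
    (E₃ := Bundle.Trivial M ℝ) (g.contMDiff.comp_contMDiffOn hf) hv hw
  exact fun y hy => (contMDiffWithinAt_totalSpace.1 (this y hy)).2

theorem contDiffOn_chartMetric (g : LorentzianMetric n M) (x₀ : M) :
    ContDiffOn ℝ ∞ (g.chartMetric x₀) (extChartAt (𝓡 (n + 1)) x₀).target := by
  refine contDiffOn_clm_apply.2 fun v => contDiffOn_clm_apply.2 fun w => ?_
  exact g.contDiffOn_inner_of_contMDiffOn (contMDiffOn_chartSymmDeriv x₀ v)
    (contMDiffOn_chartSymmDeriv x₀ w)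

theorem contDiffAt_chartMetric (g : LorentzianMetric n M) (x₀ : M) {y : 𝔼}
    (hy : y ∈ (extChartAt (𝓡 (n + 1)) x₀).target) : ContDiffAt ℝ ∞ (g.chartMetric x₀) y :=
  (g.contDiffOn_chartMetric x₀).contDiffAt ((isOpen_extChartAt_target x₀).mem_nhds hy)

end LorentzianMetric

/-! ### The transformation law of the connection coefficients -/

section Transformation

variable {E : Type*} [NormedAddCommGroup E] [NormedSpace ℝ E]

theorem fderiv_pullback_apply {G₀ G₁ : E → E →L[ℝ] E →L[ℝ] ℝ} {ψ : E → E} {y : E}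
    (hG₀ : DifferentiableAt ℝ G₀ y) (hG₁ : DifferentiableAt ℝ G₁ (ψ y)) (hψ : ContDiffAt ℝ 2 ψ y)
    (hpull : ∀ᶠ x in 𝓝 y, ∀ v w, G₀ x v w = G₁ (ψ x) (fderiv ℝ ψ x v) (fderiv ℝ ψ x w))
    (a v w : E) :
    fderiv ℝ G₀ y a v w = fderiv ℝ G₁ (ψ y) (fderiv ℝ ψ y a) (fderiv ℝ ψ y v) (fderiv ℝ ψ y w)
      + G₁ (ψ y) (fderiv ℝ (fderiv ℝ ψ) y a v) (fderiv ℝ ψ y w)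
      + G₁ (ψ y) (fderiv ℝ ψ y v) (fderiv ℝ (fderiv ℝ ψ) y a w) := by
  have hψ1 : HasFDerivAt ψ (fderiv ℝ ψ y) y := (hψ.differentiableAt (by simp)).hasFDerivAt
  have hψ2 : HasFDerivAt (fderiv ℝ ψ) (fderiv ℝ (fderiv ℝ ψ) y) y :=
    ((hψ.fderiv_right (m := 1) (by norm_num)).differentiableAt (by simp)).hasFDerivAt
  have h0 := (hG₀.hasFDerivAt.clm_apply (hasFDerivAt_const v y)).clm_apply (hasFDerivAt_const w y)
  have h1 := ((hG₁.hasFDerivAt.comp y hψ1).clm_apply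
    (hψ2.clm_apply (hasFDerivAt_const v y))).clm_apply (hψ2.clm_apply (hasFDerivAt_const w y))
  have h2 := h1.congr_of_eventuallyEq (hpull.mono fun x hx => hx v w)
  have := DFunLike.congr_fun (h0.unique h2) a
  simpa [add_comm, add_left_comm, add_assoc] using this

/-- Test both sides against the vectors `dψ z`, which exhaust the space. In the Christoffel
combination of first derivatives of `G₀`, symmetry of the second derivative of `ψ` cancels all its
contributions except the product of `D²ψ(v, v)` with `dψ z`. -/
theorem leviCivita_pullback {G₀ G₁ : E → E →L[ℝ] E →L[ℝ] ℝ} {ψ : E → E} {y : E}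
    (hG₀ : DifferentiableAt ℝ G₀ y) (hG₁ : DifferentiableAt ℝ G₁ (ψ y)) (hψ : ContDiffAt ℝ 2 ψ y)
    (hpull : ∀ᶠ x in 𝓝 y, ∀ v w, G₀ x v w = G₁ (ψ x) (fderiv ℝ ψ x v) (fderiv ℝ ψ x w))
    (hsymm : ∀ v w, G₁ (ψ y) v w = G₁ (ψ y) w v)
    (hi₀ : (G₀ y).IsInvertible) (hi₁ : (G₁ (ψ y)).IsInvertible)
    (hsurj : Function.Surjective (fderiv ℝ ψ y)) (v : E) :
    leviCivita G₁ (ψ y) (fderiv ℝ ψ y v) (fderiv ℝ ψ y v) + fderiv ℝ (fderiv ℝ ψ) y v v =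
      fderiv ℝ ψ y (leviCivita G₀ y v v) := by
  refine hi₁.injective (ContinuousLinearMap.ext fun z' => ?_)
  obtain ⟨z, rfl⟩ := hsurj z'
  rw [map_add, add_apply, apply_leviCivita hi₁, ← hpull.self_of_nhds, apply_leviCivita hi₀,
    fderiv_pullback_apply hG₀ hG₁ hψ hpull, fderiv_pullback_apply hG₀ hG₁ hψ hpull]
  have hs : fderiv ℝ (fderiv ℝ ψ) y v z = fderiv ℝ (fderiv ℝ ψ) y z v :=
    hψ.isSymmSndFDerivAt (by simp) v z
  rw [hs, hsymm (fderiv ℝ (fderiv ℝ ψ) y z v)]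
  ring

end Transformation

/-! ### Smoothness of solutions of the geodesic equation -/

/-- Bootstrap: if `c` and `v` are of class `C^k`, so are their derivatives `v` and `-Γ(c)(v, v)`. -/
theorem CoordGeodesic.contDiffOn {E : Type*} [NormedAddCommGroup E] [InnerProductSpace ℝ E]
    {Γ : E → E →L[ℝ] E →L[ℝ] E} {c v : ℝ → E} (h : CoordGeodesic Γ c v) {U : Set E}
    (hΓ : ContDiffOn ℝ ∞ Γ U) (hU : MapsTo c (Icc 0 1) U) :
    ContDiffOn ℝ ∞ c (Icc 0 1) := by
  have hud : UniqueDiffOn ℝ (Icc (0 : ℝ) 1) := uniqueDiffOn_Icc zero_lt_one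
  have key : ∀ k : ℕ, ContDiffOn ℝ k c (Icc 0 1) ∧ ContDiffOn ℝ k v (Icc 0 1) := by
    intro k
    induction k with
    | zero => exact ⟨contDiffOn_zero.2 h.continuousOn, contDiffOn_zero.2 h.continuousOn_velocity⟩
    | succ k ih =>
      obtain ⟨ihc, ihv⟩ := ih
      push_cast
      rw [contDiffOn_succ_iff_derivWithin hud, contDiffOn_succ_iff_derivWithin hud]
      refine ⟨⟨fun t ht => (h.deriv t ht).differentiableWithinAt, by simp, ?_⟩,
        ⟨fun t ht => (h.deriv₂ t ht).differentiableWithinAt, by simp, ?_⟩⟩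
      · exact ihv.congr fun t ht => (h.deriv t ht).derivWithin (hud t ht)
      · have h1 : ContDiffOn ℝ k (fun t => Γ (c t)) (Icc 0 1) :=
          (hΓ.of_le (by exact_mod_cast le_top)).comp ihc hU
        exact ((h1.clm_apply ihv).clm_apply ihv).neg.congr fun t ht =>
          (h.deriv₂ t ht).derivWithin (hud t ht)
  exact contDiffOn_infty.2 fun k => (key k).1

namespace LorentzianMetric

variable {n : ℕ} {M : Type*} [TopologicalSpace M]
  [ChartedSpace (EuclideanSpace ℝ (Fin (n + 1))) M] [IsManifold (𝓡 (n + 1)) ∞ M]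

local notation "𝔼" => EuclideanSpace ℝ (Fin (n + 1))

/-! ### Curves in a chart -/

theorem IsSmoothCurve.contDiffOn_chart {c : ℝ → M} (hc : IsSmoothCurve n c) {x₀ : M}
    (hmem : MapsTo c (Icc 0 1) (extChartAt (𝓡 (n + 1)) x₀).source) :
    ContDiffOn ℝ ∞ (fun t => extChartAt (𝓡 (n + 1)) x₀ (c t)) (Icc 0 1) := by
  rw [← contMDiffOn_iff_contDiffOn]
  refine (contMDiffOn_extChartAt (I := 𝓡 (n + 1)) (x := x₀)).comp hc fun t ht => ?_
  have := hmem ht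
  rwa [extChartAt_source] at this

theorem isSmoothCurve_chart_symm {x₀ : M} {u : ℝ → 𝔼} (hu : ContDiffOn ℝ ∞ u (Icc 0 1))
    (hmem : MapsTo u (Icc 0 1) (extChartAt (𝓡 (n + 1)) x₀).target) :
    IsSmoothCurve n (fun t => (extChartAt (𝓡 (n + 1)) x₀).symm (u t)) :=
  (contMDiffOn_extChartAt_symm (I := 𝓡 (n + 1)) x₀).comp hu.contMDiffOn hmem

theorem velocity_chart_symm {x₀ : M} {u : ℝ → 𝔼} {u' : 𝔼} {t : ℝ} (ht : t ∈ Icc (0 : ℝ) 1)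
    (hmem : u t ∈ (extChartAt (𝓡 (n + 1)) x₀).target)
    (hu : HasDerivWithinAt u u' (Icc 0 1) t) :
    velocity n (fun t => (extChartAt (𝓡 (n + 1)) x₀).symm (u t)) t =
      chartSymmDeriv x₀ (u t) u' := by
  have hud : UniqueMDiffWithinAt 𝓘(ℝ, ℝ) (Icc (0 : ℝ) 1) t :=
    ((uniqueDiffOn_Icc zero_lt_one) t ht).uniqueMDiffWithinAt
  have h1 : MDifferentiableAt 𝓘(ℝ, 𝔼) (𝓡 (n + 1)) (extChartAt (𝓡 (n + 1)) x₀).symm (u t) :=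
    ((contMDiffOn_extChartAt_symm (I := 𝓡 (n + 1)) (n := ∞) x₀).contMDiffAt
      ((isOpen_extChartAt_target x₀).mem_nhds hmem)).mdifferentiableAt (by simp)
  have h2 := hu.hasFDerivWithinAt.hasMFDerivWithinAt
  have h3 := (h1.hasMFDerivAt.comp_hasMFDerivWithinAt t h2).mfderivWithin hud
  have h4 := DFunLike.congr_fun h3 (1 : ℝ)
  refine h4.trans ?_
  change chartSymmDeriv x₀ (u t) ((ContinuousLinearMap.toSpanSingleton ℝ u') (1 : ℝ)) = _
  rw [ContinuousLinearMap.toSpanSingleton_apply, one_smul]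

omit [IsManifold (𝓡 (n + 1)) ∞ M] in
theorem velocity_congr {c₁ c₂ : ℝ → M} (h : EqOn c₁ c₂ (Icc 0 1)) {t : ℝ}
    (ht : t ∈ Icc (0 : ℝ) 1) : (velocity n c₁ t : 𝔼) = (velocity n c₂ t : 𝔼) :=
  DFunLike.congr_fun (mfderivWithin_congr (I := 𝓘(ℝ, ℝ)) (I' := 𝓡 (n + 1)) (f := c₂) (f₁ := c₁) h (h ht)) (1 : ℝ)

/-- The velocity of a curve in terms of its representation in a chart. -/
theorem velocity_eq {x₀ : M} {c : ℝ → M}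
    (hmem : MapsTo c (Icc 0 1) (extChartAt (𝓡 (n + 1)) x₀).source) {u' : 𝔼} {t : ℝ}
    (ht : t ∈ Icc (0 : ℝ) 1)
    (hu : HasDerivWithinAt (fun t => extChartAt (𝓡 (n + 1)) x₀ (c t)) u' (Icc 0 1) t) :
    (velocity n c t : 𝔼) = (chartSymmDeriv x₀ (extChartAt (𝓡 (n + 1)) x₀ (c t)) u' : 𝔼) := by
  have h1 := velocity_chart_symm ht ((extChartAt (𝓡 (n + 1)) x₀).map_source (hmem ht)) hu
  refine Eq.trans (velocity_congr (c₂ := fun t =>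
    (extChartAt (𝓡 (n + 1)) x₀).symm (extChartAt (𝓡 (n + 1)) x₀ (c t))) (fun s hs => ?_) ht) h1
  exact ((extChartAt (𝓡 (n + 1)) x₀).left_inv (hmem hs)).symm

/-- Tangent spaces at different points are different types that unfold to the same model space.
Comparing vectors in `𝔼` avoids transport along `x = y`. -/
theorem inner_congr (g : LorentzianMetric n M) {x y : M} (h : x = y) {v w v' w' : 𝔼} (hv : v = v')
    (hw : w = w') : g.inner x (v : 𝔼) (w : 𝔼) = g.inner y (v' : 𝔼) (w' : 𝔼) := by
  subst h hv hw; rfl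

theorem inner_velocity_velocity (g : LorentzianMetric n M) {x₀ : M} {c : ℝ → M}
    (hmem : MapsTo c (Icc 0 1) (extChartAt (𝓡 (n + 1)) x₀).source) {u' : 𝔼} {t : ℝ}
    (ht : t ∈ Icc (0 : ℝ) 1)
    (hu : HasDerivWithinAt (fun t => extChartAt (𝓡 (n + 1)) x₀ (c t)) u' (Icc 0 1) t) :
    g.inner (c t) (velocity n c t) (velocity n c t) =
      g.chartMetric x₀ (extChartAt (𝓡 (n + 1)) x₀ (c t)) u' u' :=
  g.inner_congr ((extChartAt (𝓡 (n + 1)) x₀).left_inv (hmem ht)).symm (velocity_eq hmem ht hu)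
    (velocity_eq hmem ht hu)

theorem inner_velocity_field (g : LorentzianMetric n M) (T : g.TimeOrientation) {x₀ : M}
    {c : ℝ → M} (hmem : MapsTo c (Icc 0 1) (extChartAt (𝓡 (n + 1)) x₀).source) {u' : 𝔼} {t : ℝ}
    (ht : t ∈ Icc (0 : ℝ) 1)
    (hu : HasDerivWithinAt (fun t => extChartAt (𝓡 (n + 1)) x₀ (c t)) u' (Icc 0 1) t) :
    g.inner (c t) (velocity n c t) (T.field (c t)) =
      g.inner ((extChartAt (𝓡 (n + 1)) x₀).symm (extChartAt (𝓡 (n + 1)) x₀ (c t)))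
        (chartSymmDeriv x₀ (extChartAt (𝓡 (n + 1)) x₀ (c t)) u') (T.field _) := by
  have h := ((extChartAt (𝓡 (n + 1)) x₀).left_inv (hmem ht)).symm
  exact g.inner_congr h (velocity_eq hmem ht hu)
    (congrArg (fun x => (T.field x : 𝔼)) h)

/-! ### Change of charts -/

/-- The change of coordinates from the chart around `x₀` to the chart around `x₁`. -/
noncomputable abbrev chartChange (x₀ x₁ : M) (y : 𝔼) : 𝔼 :=
  extChartAt (𝓡 (n + 1)) x₁ ((extChartAt (𝓡 (n + 1)) x₀).symm y)

/-- The domain of the change of coordinates. -/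
abbrev chartChangeDomain (x₀ x₁ : M) : Set 𝔼 :=
  (extChartAt (𝓡 (n + 1)) x₀).target ∩
    (extChartAt (𝓡 (n + 1)) x₀).symm ⁻¹' (extChartAt (𝓡 (n + 1)) x₁).source

omit [IsManifold (𝓡 (n + 1)) ∞ M] in
theorem isOpen_chartChangeDomain (x₀ x₁ : M) : IsOpen (chartChangeDomain (n := n) x₀ x₁) :=
  (continuousOn_extChartAt_symm x₀).isOpen_inter_preimage (isOpen_extChartAt_target x₀)
    (isOpen_extChartAt_source x₁)

theorem contDiffOn_chartChange (x₀ x₁ : M) :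
    ContDiffOn ℝ ∞ (chartChange (n := n) x₀ x₁) (chartChangeDomain x₀ x₁) := by
  rw [← contMDiffOn_iff_contDiffOn]
  refine (contMDiffOn_extChartAt (I := 𝓡 (n + 1)) (x := x₁)).comp
    ((contMDiffOn_extChartAt_symm (I := 𝓡 (n + 1)) x₀).mono inter_subset_left) fun y hy => ?_
  have := hy.2
  rwa [mem_preimage, extChartAt_source] at this

theorem contDiffAt_chartChange {x₀ x₁ : M} {y : 𝔼} (hy : y ∈ chartChangeDomain x₀ x₁) :
    ContDiffAt ℝ ∞ (chartChange (n := n) x₀ x₁) y :=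
  (contDiffOn_chartChange x₀ x₁).contDiffAt ((isOpen_chartChangeDomain x₀ x₁).mem_nhds hy)

theorem chartSymmDeriv_chartChange {x₀ x₁ : M} {y : 𝔼} (hy : y ∈ chartChangeDomain x₀ x₁)
    (v : 𝔼) : (chartSymmDeriv x₀ y v : 𝔼) =
      (chartSymmDeriv x₁ (chartChange x₀ x₁ y) (fderiv ℝ (chartChange x₀ x₁) y v) : 𝔼) := by
  have hmem : chartChange x₀ x₁ y ∈ (extChartAt (𝓡 (n + 1)) x₁).target :=
    (extChartAt (𝓡 (n + 1)) x₁).map_source hy.2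
  have h1 : MDifferentiableAt 𝓘(ℝ, 𝔼) (𝓡 (n + 1)) (extChartAt (𝓡 (n + 1)) x₁).symm
      (chartChange x₀ x₁ y) :=
    ((contMDiffOn_extChartAt_symm (I := 𝓡 (n + 1)) (n := ∞) x₁).contMDiffAt
      ((isOpen_extChartAt_target x₁).mem_nhds hmem)).mdifferentiableAt (by simp)
  have h2 := ((contDiffAt_chartChange hy).differentiableAt (by simp)).hasFDerivAt.hasMFDerivAt
  have h3 := h1.hasMFDerivAt.comp y h2
  have heq : (extChartAt (𝓡 (n + 1)) x₀).symm =ᶠ[𝓝 y]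
      (extChartAt (𝓡 (n + 1)) x₁).symm ∘ chartChange x₀ x₁ :=
    Filter.mem_of_superset ((isOpen_chartChangeDomain x₀ x₁).mem_nhds hy) fun z hz =>
      ((extChartAt (𝓡 (n + 1)) x₁).left_inv hz.2).symm
  have h4 := (h3.congr_of_eventuallyEq heq).mfderiv
  exact DFunLike.congr_fun h4 v

theorem chartMetric_chartChange (g : LorentzianMetric n M) {x₀ x₁ : M} {y : 𝔼}
    (hy : y ∈ chartChangeDomain x₀ x₁) (v w : 𝔼) :
    g.chartMetric x₀ y v w = g.chartMetric x₁ (chartChange x₀ x₁ y)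
      (fderiv ℝ (chartChange x₀ x₁) y v) (fderiv ℝ (chartChange x₀ x₁) y w) :=
  g.inner_congr ((extChartAt (𝓡 (n + 1)) x₁).left_inv hy.2).symm (chartSymmDeriv_chartChange hy v)
    (chartSymmDeriv_chartChange hy w)

theorem surjective_fderiv_chartChange {x₀ x₁ : M} {y : 𝔼} (hy : y ∈ chartChangeDomain x₀ x₁) :
    Function.Surjective (fderiv ℝ (chartChange (n := n) x₀ x₁) y) := by
  intro z
  have hmem : chartChange x₀ x₁ y ∈ (extChartAt (𝓡 (n + 1)) x₁).target :=
    (extChartAt (𝓡 (n + 1)) x₁).map_source hy.2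
  obtain ⟨v, hv⟩ := (isInvertible_chartSymmDeriv x₀ hy.1).surjective
    (chartSymmDeriv x₁ (chartChange x₀ x₁ y) z : 𝔼)
  refine ⟨v, (isInvertible_chartSymmDeriv x₁ hmem).injective ?_⟩
  exact (chartSymmDeriv_chartChange hy v).symm.trans hv

/-- The transformation law of the Christoffel symbols. -/
theorem christoffel_chartChange (g : LorentzianMetric n M) {x₀ x₁ : M} {y : 𝔼}
    (hy : y ∈ chartChangeDomain x₀ x₁) (v : 𝔼) :
    g.christoffel x₁ (chartChange x₀ x₁ y) (fderiv ℝ (chartChange x₀ x₁) y v)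
        (fderiv ℝ (chartChange x₀ x₁) y v) + fderiv ℝ (fderiv ℝ (chartChange x₀ x₁)) y v v =
      fderiv ℝ (chartChange x₀ x₁) y (g.christoffel x₀ y v v) := by
  have hmem : chartChange x₀ x₁ y ∈ (extChartAt (𝓡 (n + 1)) x₁).target :=
    (extChartAt (𝓡 (n + 1)) x₁).map_source hy.2
  have := leviCivita_pullback (G₀ := g.chartMetric x₀) (G₁ := g.chartMetric x₁)
    ((g.contDiffAt_chartMetric x₀ hy.1).differentiableAt (by simp))
    ((g.contDiffAt_chartMetric x₁ hmem).differentiableAt (by simp))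
    ((contDiffAt_chartChange hy).of_le (WithTop.coe_le_coe.2 le_top))
    (Filter.mem_of_superset ((isOpen_chartChangeDomain x₀ x₁).mem_nhds hy) fun z hz v w =>
      g.chartMetric_chartChange hz v w)
    (g.chartMetric_symm x₁ _) (g.isInvertible_chartMetric x₀ hy.1)
    (g.isInvertible_chartMetric x₁ hmem) (surjective_fderiv_chartChange hy) v
  exact this

/-! ### Geodesics in a chart -/

theorem IsGeodesic.coordGeodesic {g : LorentzianMetric n M} {c : ℝ → M} (hc : g.IsGeodesic c)
    {x₀ : M} (hmem : MapsTo c (Icc 0 1) (extChartAt (𝓡 (n + 1)) x₀).source) :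
    CoordGeodesic (leviCivita (g.chartMetric x₀)) (fun t => extChartAt (𝓡 (n + 1)) x₀ (c t))
      (derivWithin (fun t => extChartAt (𝓡 (n + 1)) x₀ (c t)) (Icc 0 1)) := by
  have hud : UniqueDiffOn ℝ (Icc (0 : ℝ) 1) := uniqueDiffOn_Icc zero_lt_one
  have hu := hc.1.contDiffOn_chart hmem
  have hu' := ((contDiffOn_infty_iff_derivWithin hud).1 hu).2
  refine ⟨fun t ht => (hu.differentiableOn (by simp) t ht).hasDerivWithinAt, fun t ht => ?_⟩
  have h1 := (hu'.differentiableOn (by simp) t ht).hasDerivWithinAt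
  rwa [eq_neg_of_add_eq_zero_left (hc.2 x₀ t ht (hmem ht))] at h1

/-- `IsGeodesic` demands the equation in every chart, while `u` solves it in one. The second
derivative of the coordinate change that appears in the other chart is exactly the inhomogeneous
term of the transformation law. -/
theorem isGeodesic_of_coordGeodesic (g : LorentzianMetric n M) {x₀ : M} {u v : ℝ → 𝔼}
    (h : CoordGeodesic (leviCivita (g.chartMetric x₀)) u v)
    (hmem : MapsTo u (Icc 0 1) (extChartAt (𝓡 (n + 1)) x₀).target) :
    g.IsGeodesic (fun t => (extChartAt (𝓡 (n + 1)) x₀).symm (u t)) := by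
  have hud : UniqueDiffOn ℝ (Icc (0 : ℝ) 1) := uniqueDiffOn_Icc zero_lt_one
  have hΓ : ContDiffOn ℝ ∞ (leviCivita (g.chartMetric x₀)) (extChartAt (𝓡 (n + 1)) x₀).target :=
    fun y hy => (contDiffAt_leviCivita (g.contDiffAt_chartMetric x₀ hy)
      (g.isInvertible_chartMetric x₀ hy)).contDiffWithinAt
  refine ⟨isSmoothCurve_chart_symm (h.contDiffOn hΓ hmem) hmem, fun x₁ t ht hsrc => ?_⟩
  intro w w' w''
  have hdom : u t ∈ chartChangeDomain x₀ x₁ := ⟨hmem ht, hsrc⟩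
  -- The curve need not stay in the second chart, so the formula for `w'` is available only near
  -- `t`; this suffices for differentiating it at `t`.
  have hev : ∀ᶠ s in 𝓝[Icc 0 1] t, u s ∈ chartChangeDomain x₀ x₁ :=
    h.continuousOn t ht ((isOpen_chartChangeDomain x₀ x₁).mem_nhds hdom)
  have hw : ∀ s ∈ Icc (0 : ℝ) 1, u s ∈ chartChangeDomain x₀ x₁ →
      w' s = fderiv ℝ (chartChange x₀ x₁) (u s) (v s) := fun s hs hs' =>
    ((((contDiffAt_chartChange hs').differentiableAt (by simp)).hasFDerivAt.comp_hasDerivWithinAt s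
      (h.deriv s hs)).derivWithin (hud s hs))
  have hd : HasDerivWithinAt (fun s => fderiv ℝ (chartChange x₀ x₁) (u s) (v s))
      (fderiv ℝ (fderiv ℝ (chartChange x₀ x₁)) (u t) (v t) (v t) +
        fderiv ℝ (chartChange x₀ x₁) (u t) (-(g.christoffel x₀ (u t) (v t) (v t))))
      (Icc 0 1) t := by
    have h2 : DifferentiableAt ℝ (fderiv ℝ (chartChange x₀ x₁)) (u t) :=
      ((contDiffAt_chartChange hdom).fderiv_right (m := ∞) (by simp)).differentiableAt (by simp)
    exact (h2.hasFDerivAt.comp_hasDerivWithinAt t (h.deriv t ht)).clm_apply (h.deriv₂ t ht)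
  have hw'' : w'' t = fderiv ℝ (fderiv ℝ (chartChange x₀ x₁)) (u t) (v t) (v t) +
        fderiv ℝ (chartChange x₀ x₁) (u t) (-(g.christoffel x₀ (u t) (v t) (v t))) := by
    refine HasDerivWithinAt.derivWithin ?_ (hud t ht)
    refine hd.congr_of_eventuallyEq ?_ (hw t ht hdom)
    filter_upwards [hev, self_mem_nhdsWithin] with s hs hs'
    exact hw s hs' hs
  rw [hw'', hw t ht hdom, map_neg, ← g.christoffel_chartChange hdom]
  abel

end LorentzianMetric

theorem ContDiffAt.exists_closedBall_bound {E F : Type*} [NormedAddCommGroup E]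
    [NormedSpace ℝ E] [NormedAddCommGroup F] [NormedSpace ℝ F] {f : E → F} {x₀ : E}
    (hf : ContDiffAt ℝ 1 f x₀) : ∃ δ > 0, ∃ C : ℝ, 0 ≤ C ∧
      (∀ x ∈ Metric.closedBall x₀ δ, ‖f x‖ ≤ C) ∧
      ∀ x ∈ Metric.closedBall x₀ δ, ∀ y ∈ Metric.closedBall x₀ δ, ‖f x - f y‖ ≤ C * ‖x - y‖ := by
  obtain ⟨L, s, hs, hL⟩ := hf.exists_lipschitzOnWith
  have hb : ∀ᶠ x in 𝓝 x₀, ‖f x‖ < ‖f x₀‖ + 1 :=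
    hf.continuousAt.norm.eventually_lt_const (by simp)
  obtain ⟨δ, hδ, hδs⟩ := Metric.nhds_basis_closedBall.mem_iff.1 (Filter.inter_mem hs hb)
  refine ⟨δ, hδ, max L (‖f x₀‖ + 1), le_max_of_le_left L.2, fun x hx => ?_, fun x hx y hy => ?_⟩
  · exact le_max_of_le_right (hδs hx).2.le
  · have := hL.dist_le_mul x (hδs hx).1 y (hδs hy).1
    rw [dist_eq_norm, dist_eq_norm] at this
    exact this.trans (by gcongr; exact le_max_left _ _)

namespace LorentzianMetric

variable {n : ℕ} {M : Type*} [TopologicalSpace M]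
  [ChartedSpace (EuclideanSpace ℝ (Fin (n + 1))) M] [IsManifold (𝓡 (n + 1)) ∞ M]

local notation "𝔼" => EuclideanSpace ℝ (Fin (n + 1))

/-! ### Small balls in a chart -/

/-- A ball in the chart around `x₀` on which the metric is controlled, with a constant timelike
vector `T₀` that represents the time orientation. -/
structure CausalChart (g : LorentzianMetric n M) (T : g.TimeOrientation) (x₀ : M) (T₀ : 𝔼)
    (a K N : ℝ) : Prop extends
    LorentzBall (g.chartMetric x₀) (leviCivita (g.chartMetric x₀)) T₀
      (extChartAt (𝓡 (n + 1)) x₀ x₀) a K N where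
  subset : Metric.closedBall (extChartAt (𝓡 (n + 1)) x₀ x₀) a ⊆
    (extChartAt (𝓡 (n + 1)) x₀).target
  field : ∀ y ∈ Metric.closedBall (extChartAt (𝓡 (n + 1)) x₀ x₀) a,
    g.inner ((extChartAt (𝓡 (n + 1)) x₀).symm y)
      (T.field ((extChartAt (𝓡 (n + 1)) x₀).symm y)) (chartSymmDeriv x₀ y T₀) < 0

theorem exists_causalChart (g : LorentzianMetric n M) (T : g.TimeOrientation) (x₀ : M) :
    ∃ (T₀ : 𝔼) (a K N : ℝ), g.CausalChart T x₀ T₀ a K N := by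
  set y₀ := extChartAt (𝓡 (n + 1)) x₀ x₀ with hy₀
  have hmem : y₀ ∈ (extChartAt (𝓡 (n + 1)) x₀).target := mem_extChartAt_target x₀
  -- `T₀` is the coordinate vector of the time orientation at the center, extended as a constant.
  -- Being timelike and in the cone of `T` are open conditions, so they persist nearby.
  obtain ⟨T₀, hT₀⟩ := (isInvertible_chartSymmDeriv x₀ hmem).surjective
    (T.field ((extChartAt (𝓡 (n + 1)) x₀).symm y₀))
  have hG := g.contDiffAt_chartMetric x₀ hmem
  obtain ⟨δ₁, hδ₁, K, hK, hK1, hK2⟩ := ((contDiffAt_leviCivita hG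
    (g.isInvertible_chartMetric x₀ hmem)).of_le (m := 1)
      (WithTop.coe_le_coe.2 le_top)).exists_closedBall_bound
  obtain ⟨δ₂, hδ₂, N₁, hN₁, hG1, -⟩ := (hG.of_le (m := 1)
    (WithTop.coe_le_coe.2 le_top)).exists_closedBall_bound
  obtain ⟨δ₃, hδ₃, N₂, hN₂, hD1, hD2⟩ := (hG.fderiv_right (m := 1)
    (WithTop.coe_le_coe.2 le_top)).exists_closedBall_bound
  have e1 : ∀ᶠ y in 𝓝 y₀, y ∈ (extChartAt (𝓡 (n + 1)) x₀).target :=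
    (isOpen_extChartAt_target x₀).mem_nhds hmem
  have e2 : ∀ᶠ y in 𝓝 y₀, g.chartMetric x₀ y T₀ T₀ < 0 := by
    have hc : ContinuousAt (fun y => g.chartMetric x₀ y T₀ T₀) y₀ :=
      (hG.continuousAt.clm_apply continuousAt_const).clm_apply continuousAt_const
    refine hc.eventually_lt_const ?_
    change g.inner _ (chartSymmDeriv x₀ y₀ T₀) (chartSymmDeriv x₀ y₀ T₀) < 0
    rw [hT₀]
    exact T.timelike _
  have e3 : ∀ᶠ y in 𝓝 y₀, g.inner ((extChartAt (𝓡 (n + 1)) x₀).symm y)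
      (T.field ((extChartAt (𝓡 (n + 1)) x₀).symm y)) (chartSymmDeriv x₀ y T₀) < 0 := by
    have hc := (g.contDiffOn_inner_of_contMDiffOn
      (T.contMDiff.comp_contMDiffOn (contMDiffOn_extChartAt_symm (I := 𝓡 (n + 1)) x₀))
      (contMDiffOn_chartSymmDeriv x₀ T₀)).continuousOn.continuousAt
      ((isOpen_extChartAt_target x₀).mem_nhds hmem)
    refine hc.eventually_lt_const ?_
    beta_reduce
    rw [hT₀]
    exact T.timelike _
  obtain ⟨δ₄, hδ₄, hδ₄s⟩ := Metric.nhds_basis_closedBall.mem_iff.1 (e1.and (e2.and e3))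
  -- The last entry yields both `a ≤ 1` and `16 * K * a ≤ 1`.
  set a := min (min δ₁ δ₂) (min (min δ₃ δ₄) (1 / (16 * K + 1))) with ha
  have ha0 : 0 < a := by positivity
  have a1 : Metric.closedBall y₀ a ⊆ Metric.closedBall y₀ δ₁ :=
    Metric.closedBall_subset_closedBall ((min_le_left _ _).trans (min_le_left _ _))
  have a2 : Metric.closedBall y₀ a ⊆ Metric.closedBall y₀ δ₂ :=
    Metric.closedBall_subset_closedBall ((min_le_left _ _).trans (min_le_right _ _))
  have a3 : Metric.closedBall y₀ a ⊆ Metric.closedBall y₀ δ₃ :=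
    Metric.closedBall_subset_closedBall
      ((min_le_right _ _).trans ((min_le_left _ _).trans (min_le_left _ _)))
  have a4 : Metric.closedBall y₀ a ⊆ Metric.closedBall y₀ δ₄ :=
    Metric.closedBall_subset_closedBall
      ((min_le_right _ _).trans ((min_le_left _ _).trans (min_le_right _ _)))
  have a5 : a ≤ 1 / (16 * K + 1) := (min_le_right _ _).trans (min_le_right _ _)
  have a6 : a * (16 * K + 1) ≤ 1 := (le_div_iff₀ (by positivity)).1 a5
  have hsub : Metric.closedBall y₀ a ⊆ (extChartAt (𝓡 (n + 1)) x₀).target :=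
    fun y hy => (hδ₄s (a4 hy)).1
  exact ⟨T₀, a, K, max N₁ N₂,
    { pos := ha0
      le_one := by nlinarith
      nonneg := hK
      small := by linarith
      norm_le := fun x hx => hK1 x (a1 hx)
      lipschitz := fun x hx y hy => hK2 x (a1 hx) y (a1 hy)
      symm := g.chartMetric_symm x₀
      differentiableAt := fun x hx =>
        (g.contDiffAt_chartMetric x₀ (hsub hx)).differentiableAt (by simp)
      metric_norm_le := fun x hx => (hG1 x (a2 hx)).trans (le_max_left _ _)
      fderiv_norm_le := fun x hx => (hD1 x (a3 hx)).trans (le_max_right _ _)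
      fderiv_lipschitz := fun x hx y hy => (hD2 x (a3 hx) y (a3 hy)).trans
        (mul_le_mul_of_nonneg_right (le_max_right _ _) (norm_nonneg _))
      christoffel := fun x hx v z => apply_leviCivita (g.isInvertible_chartMetric x₀ (hsub hx)) v z
      timelike := fun x hx => (hδ₄s (a4 hx)).2.1
      spacelike := fun x hx v hv => g.chartMetric_pos_of_orthogonal x₀ (hsub hx)
        (hδ₄s (a4 hx)).2.1 hv
      subset := hsub
      field := fun y hy => (hδ₄s (a4 hy)).2.2 }⟩

/-- The part of `M` that corresponds to a ball in the chart around `x₀`. -/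
def chartBall (n : ℕ) {M : Type*} [TopologicalSpace M]
    [ChartedSpace (EuclideanSpace ℝ (Fin (n + 1))) M] (x₀ : M) (r : ℝ) : Set M :=
  (extChartAt (𝓡 (n + 1)) x₀).source ∩
    extChartAt (𝓡 (n + 1)) x₀ ⁻¹' Metric.ball (extChartAt (𝓡 (n + 1)) x₀ x₀) r

omit [IsManifold (𝓡 (n + 1)) ∞ M] in
theorem isOpen_chartBall (x₀ : M) (r : ℝ) : IsOpen (chartBall n x₀ r) :=
  (continuousOn_extChartAt x₀).isOpen_inter_preimage (isOpen_extChartAt_source x₀)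
    Metric.isOpen_ball

namespace CausalChart

variable {g : LorentzianMetric n M} {T : g.TimeOrientation} {x₀ : M}
  {T₀ : EuclideanSpace ℝ (Fin (n + 1))} {a K N : ℝ}

local notation "φ" => extChartAt (𝓡 (n + 1)) x₀
local notation "𝓑" => Metric.ball (extChartAt (𝓡 (n + 1)) x₀ x₀) (a / 16)
local notation "𝓥" => chartBall n x₀ (a / 16)

theorem ball_subset_target (h : g.CausalChart T x₀ T₀ a K N) : 𝓑 ⊆ (φ).target :=
  h.ball_subset.trans h.subset

theorem mem_chartBall (h : g.CausalChart T x₀ T₀ a K N) : x₀ ∈ 𝓥 :=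
  ⟨mem_extChartAt_source x₀, Metric.mem_ball_self (by linarith [h.pos])⟩

theorem symm_mem_chartBall (h : g.CausalChart T x₀ T₀ a K N) {y : 𝔼} (hy : y ∈ 𝓑) :
    (φ).symm y ∈ 𝓥 := by
  refine ⟨(φ).map_target (h.ball_subset_target hy), ?_⟩
  rwa [mem_preimage, (φ).right_inv (h.ball_subset_target hy)]

/-- The time orientation varies from point to point, while the chart argument uses the constant
`T₀`. Both are timelike in the same cone, so they select the same half of the causal vectors. -/
theorem futurePointing_iff (h : g.CausalChart T x₀ T₀ a K N) {y : 𝔼} (hy : y ∈ 𝓑) {v : 𝔼}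
    (hv0 : v ≠ 0) (hv : g.chartMetric x₀ y v v ≤ 0) :
    g.inner ((φ).symm y) (chartSymmDeriv x₀ y v) (T.field ((φ).symm y)) < 0 ↔
      g.chartMetric x₀ y v T₀ < 0 := by
  have hyt := h.ball_subset_target hy
  have hy' := h.ball_subset hy
  exact lorentzForm_apply_neg_iff (β := g.inner ((φ).symm y)) (g.symm _)
    (T := chartSymmDeriv x₀ y T₀)
    (fun w hw hwT => g.inner_pos_of_orthogonal (h.timelike y hy') hw hwT)
    (T.timelike _) (h.field y hy') (chartSymmDeriv_ne_zero x₀ hyt hv0) hv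

/-! #### From curves in the chart to curves in the manifold -/

theorem connects_chart_symm (h : g.CausalChart T x₀ T₀ a K N) {u : ℝ → 𝔼}
    (hu : MapsTo u (Icc 0 1) 𝓑) {p q : M} (hp : p ∈ 𝓥) (hq : q ∈ 𝓥) (h0 : u 0 = φ p)
    (h1 : u 1 = φ q) : Connects 𝓥 p q (fun t => (φ).symm (u t)) :=
  ⟨by simp only [h0, (φ).left_inv hp.1], by simp only [h1, (φ).left_inv hq.1],
    fun t ht => h.symm_mem_chartBall (hu ht)⟩

theorem inner_velocity_chart_symm (h : g.CausalChart T x₀ T₀ a K N) {u u' : ℝ → 𝔼}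
    (hu : MapsTo u (Icc 0 1) 𝓑) {t : ℝ} (ht : t ∈ Icc (0 : ℝ) 1)
    (hd : HasDerivWithinAt u (u' t) (Icc 0 1) t) :
    g.inner ((φ).symm (u t)) (velocity n (fun t => (φ).symm (u t)) t)
      (velocity n (fun t => (φ).symm (u t)) t) = g.chartMetric x₀ (u t) (u' t) (u' t) := by
  rw [velocity_chart_symm ht (h.ball_subset_target (hu ht)) hd]
  rfl

theorem isFutureDirected_chart_symm (h : g.CausalChart T x₀ T₀ a K N) {u u' : ℝ → 𝔼}
    (hu : MapsTo u (Icc 0 1) 𝓑)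
    (hd : ∀ t ∈ Icc (0 : ℝ) 1, HasDerivWithinAt u (u' t) (Icc 0 1) t)
    (hcau : ∀ t ∈ Icc (0 : ℝ) 1, g.chartMetric x₀ (u t) (u' t) (u' t) ≤ 0)
    (hfut : ∀ t ∈ Icc (0 : ℝ) 1, u' t ≠ 0 → g.chartMetric x₀ (u t) (u' t) T₀ < 0) :
    g.IsFutureDirected T (fun t => (φ).symm (u t)) := by
  intro t ht hne
  rw [FuturePointing]
  rw [velocity_chart_symm ht (h.ball_subset_target (hu ht)) (hd t ht)] at hne ⊢
  have hne' : u' t ≠ 0 := fun h0 => hne (by rw [h0, map_zero])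
  exact (h.futurePointing_iff (hu ht) hne' (hcau t ht)).2 (hfut t ht hne')

/-! #### From curves in the manifold to curves in the chart -/

theorem hasDerivWithinAt_chart {c : ℝ → M} (hc : IsSmoothCurve n c)
    (hmem : MapsTo c (Icc 0 1) 𝓥) {t : ℝ} (ht : t ∈ Icc (0 : ℝ) 1) :
    HasDerivWithinAt (fun t => φ (c t)) (derivWithin (fun t => φ (c t)) (Icc 0 1) t)
      (Icc 0 1) t :=
  ((hc.contDiffOn_chart fun _ hs => (hmem hs).1).differentiableOn (by simp) t ht).hasDerivWithinAt

theorem chartMetric_velocity {c : ℝ → M} (hc : IsSmoothCurve n c)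
    (hmem : MapsTo c (Icc 0 1) 𝓥) {t : ℝ} (ht : t ∈ Icc (0 : ℝ) 1) :
    g.chartMetric x₀ (φ (c t)) (derivWithin (fun t => φ (c t)) (Icc 0 1) t)
      (derivWithin (fun t => φ (c t)) (Icc 0 1) t) =
      g.inner (c t) (velocity n c t) (velocity n c t) :=
  (g.inner_velocity_velocity (fun _ hs => (hmem hs).1) ht (hasDerivWithinAt_chart hc hmem ht)).symm

theorem chartMetric_future (h : g.CausalChart T x₀ T₀ a K N) {c : ℝ → M}
    (hc : IsSmoothCurve n c) (hmem : MapsTo c (Icc 0 1) 𝓥) (hcau : g.IsNonSpacelike c)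
    (hfut : g.IsFutureDirected T c) {t : ℝ} (ht : t ∈ Icc (0 : ℝ) 1)
    (hne : derivWithin (fun t => φ (c t)) (Icc 0 1) t ≠ 0) :
    g.chartMetric x₀ (φ (c t)) (derivWithin (fun t => φ (c t)) (Icc 0 1) t) T₀ < 0 := by
  have hsrc : MapsTo c (Icc 0 1) (φ).source := fun _ hs => (hmem hs).1
  have hd := hasDerivWithinAt_chart hc hmem ht
  refine (h.futurePointing_iff (hmem ht).2 hne ?_).1 ?_
  · rw [chartMetric_velocity hc hmem ht]
    exact hcau t ht
  · rw [← g.inner_velocity_field T hsrc ht hd]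
    refine hfut t ht fun h0 => ?_
    have h1 : (velocity n c t : 𝔼) = 0 := h0
    rw [velocity_eq hsrc ht hd] at h1
    exact chartSymmDeriv_ne_zero x₀ ((φ).map_source (hsrc ht)) hne h1

/-! #### Geodesics -/

theorem geodesicallyConvex (h : g.CausalChart T x₀ T₀ a K N) : g.GeodesicallyConvex 𝓥 := by
  intro p hp q hq
  constructor
  · obtain ⟨u, v, hu, h0, h1, hm⟩ := h.exists_geodesic hp.2 hq.2
    exact ⟨_, g.isGeodesic_of_coordGeodesic hu (hm.mono_right h.ball_subset_target),
      h.connects_chart_symm hm hp hq h0 h1⟩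
  · rintro c₁ c₂ g₁ ⟨p₁, q₁, m₁⟩ g₂ ⟨p₂, q₂, m₂⟩ t ht
    have := (h.eqOn_of_endpoints (g₁.coordGeodesic fun _ hs => (m₁ hs).1)
      (g₂.coordGeodesic fun _ hs => (m₂ hs).1) (fun _ hs => (m₁ hs).2) (fun _ hs => (m₂ hs).2)
      (by simp only [p₁, p₂]) (by simp only [q₁, q₂])).1 ht
    exact (φ).injOn (m₁ ht).1 (m₂ ht).1 this

variable {p : M} {c v : EuclideanSpace ℝ (Fin (n + 1)) → ℝ → EuclideanSpace ℝ (Fin (n + 1))}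

/-- The radial geodesics, as curves in the manifold. -/
theorem radial_geodesic (h : g.CausalChart T x₀ T₀ a K N)
    (hR : RadialGeodesics (leviCivita (g.chartMetric x₀)) 𝓑 (φ p) c v) (hp : p ∈ 𝓥) {q : M}
    (hq : q ∈ 𝓥) : g.IsGeodesic (fun t => (φ).symm (c (φ q) t)) ∧
      Connects 𝓥 p q (fun t => (φ).symm (c (φ q) t)) :=
  ⟨g.isGeodesic_of_coordGeodesic (hR.geodesic _ hq.2)
      ((hR.mapsTo _ hq.2).mono_right h.ball_subset_target),
    h.connects_chart_symm (hR.mapsTo _ hq.2) hp hq (hR.left _ hq.2) (hR.right _ hq.2)⟩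

theorem inner_velocity_radial (h : g.CausalChart T x₀ T₀ a K N)
    (hR : RadialGeodesics (leviCivita (g.chartMetric x₀)) 𝓑 (φ p) c v) {q : M}
    (hq : q ∈ 𝓥) {t : ℝ} (ht : t ∈ Icc (0 : ℝ) 1) :
    g.inner ((φ).symm (c (φ q) t)) (velocity n (fun t => (φ).symm (c (φ q) t)) t)
      (velocity n (fun t => (φ).symm (c (φ q) t)) t) =
      g.chartMetric x₀ (φ p) (v (φ q) 0) (v (φ q) 0) := by
  have hg := hR.geodesic _ hq.2
  have hm := hR.mapsTo _ hq.2
  rw [h.inner_velocity_chart_symm hm ht (hg.deriv t ht),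
    h.speed_eq hg (hm.mono_right h.ball_subset) ht, hR.left _ hq.2]

/-- The weak inequality against `T₀` is what survives a limit. It becomes strict when the initial
velocity is nonzero; otherwise the geodesic is constant. -/
theorem isFutureDirected_radial (h : g.CausalChart T x₀ T₀ a K N)
    (hR : RadialGeodesics (leviCivita (g.chartMetric x₀)) 𝓑 (φ p) c v) (hp : p ∈ 𝓥) {q : M}
    (hq : q ∈ 𝓥) (hcau : g.chartMetric x₀ (φ p) (v (φ q) 0) (v (φ q) 0) ≤ 0)
    (hfut : g.chartMetric x₀ (φ p) (v (φ q) 0) T₀ ≤ 0) :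
    g.IsFutureDirected T (fun t => (φ).symm (c (φ q) t)) := by
  have hg := hR.geodesic _ hq.2
  have hm := hR.mapsTo _ hq.2
  have hm' := hm.mono_right h.ball_subset
  refine h.isFutureDirected_chart_symm hm hg.deriv (fun t ht => ?_) fun t ht hne => ?_
  · rw [h.speed_eq hg hm' ht, hR.left _ hq.2]
    exact hcau
  · have hne0 : v (φ q) 0 ≠ 0 := fun h0 => hne
      (h.velocity_eq_zero hg hm' (h.velocity_le hg hm) (left_mem_Icc.2 zero_le_one) h0 ht)
    refine h.future_of_initial hg hm ?_ ?_ ht <;> rw [hR.left _ hq.2]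
    · exact hcau
    · exact lt_of_le_of_ne hfut (h.apply_ne_zero (h.ball_subset hp.2) hne0 hcau)

theorem chronologicalFuture_subset (h : g.CausalChart T x₀ T₀ a K N)
    (hR : RadialGeodesics (leviCivita (g.chartMetric x₀)) 𝓑 (φ p) c v) {q : M}
    (hq : q ∈ g.chronologicalFuture T 𝓥 p) :
    q ∈ 𝓥 ∧ g.chartMetric x₀ (φ p) (v (φ q) 0) (v (φ q) 0) < 0 ∧
      g.chartMetric x₀ (φ p) (v (φ q) 0) T₀ < 0 := by
  obtain ⟨γ, hγ, ⟨h0, h1, hm⟩, htl, hfut⟩ := hq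
  refine ⟨h1 ▸ hm (right_mem_Icc.2 zero_le_one), ?_⟩
  have htl' : ∀ t ∈ Icc (0 : ℝ) 1, g.chartMetric x₀ (φ (γ t))
      (derivWithin (fun t => φ (γ t)) (Icc 0 1) t)
      (derivWithin (fun t => φ (γ t)) (Icc 0 1) t) < 0 := fun t ht => by
    rw [chartMetric_velocity hγ hm ht]
    exact htl t ht
  have := h.initialVelocity_timelike hR (γ := fun t => φ (γ t))
    (fun t ht => hasDerivWithinAt_chart hγ hm ht) (fun t ht => (hm ht).2) (by simp only [h0]) htl'
    fun t ht => h.chartMetric_future hγ hm (fun t ht => (htl t ht).le) hfut ht fun h' => by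
      have := htl' t ht
      rw [h'] at this
      simp at this
  simpa only [h1] using this

theorem mem_chronologicalFuture_iff (h : g.CausalChart T x₀ T₀ a K N) (hp : p ∈ 𝓥) {q : M}
    (hq : q ∈ 𝓥) : q ∈ g.chronologicalFuture T 𝓥 p ↔
      ∃ c : ℝ → M, g.IsGeodesic c ∧ Connects 𝓥 p q c ∧ g.IsTimelike c ∧
        g.IsFutureDirected T c := by
  constructor
  · intro hmem
    obtain ⟨c, v, hR⟩ := h.exists_radialGeodesics hp.2
    obtain ⟨-, h1, h2⟩ := h.chronologicalFuture_subset hR hmem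
    obtain ⟨k1, k2⟩ := h.radial_geodesic hR hp hq
    exact ⟨_, k1, k2, fun t ht => (h.inner_velocity_radial hR hq ht).trans_lt h1,
      h.isFutureDirected_radial hR hp hq h1.le h2.le⟩
  · rintro ⟨c, hc, hcon, htl, hfut⟩
    exact ⟨c, hc.1, hcon, htl, hfut⟩

/-- The initial velocity of the radial geodesic is continuous in its end point, so the strict
inequalities valid on `I⁺(p)` pass to weak ones on the closure. -/
theorem closure_chronologicalFuture_subset (h : g.CausalChart T x₀ T₀ a K N)
    (hR : RadialGeodesics (leviCivita (g.chartMetric x₀)) 𝓑 (φ p) c v) {q : M}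
    (hq : q ∈ 𝓥) (hcl : q ∈ closure (g.chronologicalFuture T 𝓥 p)) :
    g.chartMetric x₀ (φ p) (v (φ q) 0) (v (φ q) 0) ≤ 0 ∧
      g.chartMetric x₀ (φ p) (v (φ q) 0) T₀ ≤ 0 := by
  have hφ : ContinuousAt φ q := continuousAt_extChartAt' hq.1
  have hw : ContinuousAt (fun q => v (φ q) 0) q :=
    ContinuousAt.comp (f := φ) (g := fun y => v y 0)
      ((h.continuousOn_initialVelocity hR).continuousAt (Metric.isOpen_ball.mem_nhds hq.2)) hφ
  have h1 : ContinuousAt (fun q => g.chartMetric x₀ (φ p) (v (φ q) 0) (v (φ q) 0)) q :=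
    (continuousAt_const.clm_apply hw).clm_apply hw
  have h2 : ContinuousAt (fun q => g.chartMetric x₀ (φ p) (v (φ q) 0) T₀) q :=
    (continuousAt_const.clm_apply hw).clm_apply continuousAt_const
  have : (𝓝[g.chronologicalFuture T 𝓥 p] q).NeBot := mem_closure_iff_nhdsWithin_neBot.1 hcl
  exact ⟨le_of_tendsto (h1.mono_left nhdsWithin_le_nhds)
      (Filter.mem_of_superset self_mem_nhdsWithin fun q' hq' =>
        (h.chronologicalFuture_subset hR hq').2.1.le),
    le_of_tendsto (h2.mono_left nhdsWithin_le_nhds)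
      (Filter.mem_of_superset self_mem_nhdsWithin fun q' hq' =>
        (h.chronologicalFuture_subset hR hq').2.2.le)⟩

theorem causalFuture_subset_closure (h : g.CausalChart T x₀ T₀ a K N) :
    g.causalFuture T 𝓥 p ⊆ closure (g.chronologicalFuture T 𝓥 p) := by
  rintro q ⟨γ, hγ, ⟨h0, h1, hm⟩, hcau, hfut⟩
  have z : (0 : ℝ) ∈ Icc (0 : ℝ) 1 := left_mem_Icc.2 zero_le_one
  have o : (1 : ℝ) ∈ Icc (0 : ℝ) 1 := right_mem_Icc.2 zero_le_one
  have hp : p ∈ 𝓥 := h0 ▸ hm z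
  have hq : q ∈ 𝓥 := h1 ▸ hm o
  have hu : ContDiffOn ℝ ∞ (fun t => φ (γ t)) (Icc 0 1) :=
    hγ.contDiffOn_chart fun _ hs => (hm hs).1
  have hu' := ((contDiffOn_infty_iff_derivWithin (uniqueDiffOn_Icc zero_lt_one)).1 hu).2.continuousOn
  set u : ℝ → 𝔼 := fun t => φ (γ t) with hu_def
  have hd : ∀ t ∈ Icc (0 : ℝ) 1, HasDerivWithinAt u (derivWithin u (Icc 0 1) t) (Icc 0 1) t :=
    fun t ht => hasDerivWithinAt_chart hγ hm ht
  obtain ⟨l, -, hev⟩ := h.exists_timelike_perturbation hu.continuousOn hu' (fun t ht => (hm ht).2)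
    (fun t ht => (chartMetric_velocity hγ hm ht).trans_le (hcau t ht))
    (fun t ht hne => h.chartMetric_future hγ hm hcau hfut ht hne)
  -- The factor `exp (l t) - 1` vanishes at `t = 0`, so the perturbed curve still starts at `p`; its
  -- end point tends to `q` as `ε → 0`.
  have hev' : ∀ᶠ ε in 𝓝[>] (0 : ℝ), (φ).symm (u 1 + (ε * (Real.exp (l * 1) - 1)) • T₀) ∈
      g.chronologicalFuture T 𝓥 p := by
    filter_upwards [hev] with ε hε
    set w : ℝ → 𝔼 := fun t => u t + (ε * (Real.exp (l * t) - 1)) • T₀ with hw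
    have hwm : MapsTo w (Icc 0 1) 𝓑 := fun t ht => (hε t ht).1
    have hwd : ∀ t ∈ Icc (0 : ℝ) 1, HasDerivWithinAt w
        (derivWithin u (Icc 0 1) t + (ε * (l * Real.exp (l * t))) • T₀) (Icc 0 1) t := by
      intro t ht
      have h3 : HasDerivAt (fun t => ε * (Real.exp (l * t) - 1)) (ε * (l * Real.exp (l * t))) t := by
        have := (((hasDerivAt_id t).const_mul l).exp.sub_const 1).const_mul ε
        simpa [mul_comm] using! this
      exact (hd t ht).add (h3.hasDerivWithinAt.smul_const T₀)
    have hws : ContDiffOn ℝ ∞ w (Icc 0 1) := by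
      have : ContDiff ℝ ∞ fun t : ℝ => (ε * (Real.exp (l * t) - 1)) • T₀ := by fun_prop
      exact hu.add this.contDiffOn
    refine ⟨fun t => (φ).symm (w t),
      isSmoothCurve_chart_symm hws (hwm.mono_right h.ball_subset_target),
      ⟨?_, rfl, fun t ht => h.symm_mem_chartBall (hwm ht)⟩, fun t ht => ?_, ?_⟩
    · have hw0 : w 0 = φ p := by simp [hw, hu_def, h0]
      simp only [hw0, (φ).left_inv hp.1]
    · refine (h.inner_velocity_chart_symm (u' := fun t => derivWithin u (Icc 0 1) t +
        (ε * (l * Real.exp (l * t))) • T₀) hwm ht (hwd t ht)).trans_lt (hε t ht).2.1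
    · exact h.isFutureDirected_chart_symm hwm hwd (fun t ht => (hε t ht).2.1.le)
        fun t ht _ => (hε t ht).2.2
  refine mem_closure_of_tendsto ?_ hev'
  have hφ : ContinuousAt (φ).symm (u 1) :=
    (continuousOn_extChartAt_symm x₀).continuousAt
      ((isOpen_extChartAt_target x₀).mem_nhds (h.ball_subset_target (hm o).2))
  have hlim : Filter.Tendsto (fun ε : ℝ => u 1 + (ε * (Real.exp (l * 1) - 1)) • T₀) (𝓝[>] 0)
      (𝓝 (u 1)) := by
    have : Continuous fun ε : ℝ => u 1 + (ε * (Real.exp (l * 1) - 1)) • T₀ := by fun_prop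
    have h4 := this.tendsto 0
    simp only [zero_mul, zero_smul, add_zero] at h4
    exact h4.mono_left nhdsWithin_le_nhds
  have h5 := hφ.tendsto.comp hlim
  have h6 : (φ).symm (u 1) = q := by rw [hu_def]; simp only [h1]; exact (φ).left_inv hq.1
  rwa [h6] at h5

/-- Points in the closure of the chronological future are reached by causal geodesics. -/
theorem exists_causal_geodesic (h : g.CausalChart T x₀ T₀ a K N) (hp : p ∈ 𝓥) {q : M}
    (hq : q ∈ 𝓥) (hcl : q ∈ closure (g.chronologicalFuture T 𝓥 p)) :
    ∃ c : ℝ → M, g.IsGeodesic c ∧ Connects 𝓥 p q c ∧ (g.IsTimelike c ∨ g.IsNull c) ∧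
      g.IsFutureDirected T c := by
  obtain ⟨c, v, hR⟩ := h.exists_radialGeodesics hp.2
  obtain ⟨h1, h2⟩ := h.closure_chronologicalFuture_subset hR hq hcl
  obtain ⟨k1, k2⟩ := h.radial_geodesic hR hp hq
  refine ⟨_, k1, k2, ?_, h.isFutureDirected_radial hR hp hq h1 h2⟩
  rcases h1.lt_or_eq with h3 | h3
  · exact Or.inl fun t ht => (h.inner_velocity_radial hR hq ht).trans_lt h3
  · exact Or.inr fun t ht => (h.inner_velocity_radial hR hq ht).trans h3

end CausalChart

/-! ### Assembly of the four statements. -/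

theorem causalFuture_subset {g : LorentzianMetric n M} {T : g.TimeOrientation} {V : Set M}
    {p : M} : g.causalFuture T V p ⊆ V := by
  rintro q ⟨γ, -, ⟨-, h1, hm⟩, -⟩
  exact h1 ▸ hm (right_mem_Icc.2 zero_le_one)

theorem mem_causalFuture_of_geodesic {g : LorentzianMetric n M} {T : g.TimeOrientation}
    {V : Set M} {p q : M} (h : ∃ c : ℝ → M, g.IsGeodesic c ∧ Connects V p q c ∧
      (g.IsTimelike c ∨ g.IsNull c) ∧ g.IsFutureDirected T c) : q ∈ g.causalFuture T V p := by
  obtain ⟨c, hc, hcon, htl | hnull, hfut⟩ := h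
  · exact ⟨c, hc.1, hcon, fun t ht => (htl t ht).le, hfut⟩
  · exact ⟨c, hc.1, hcon, fun t ht => (hnull t ht).le, hfut⟩

end LorentzianMetric

theorem mainTheorem8 (n : ℕ) {M : Type*} [TopologicalSpace M] [T2Space M]
    [ChartedSpace (EuclideanSpace ℝ (Fin (n + 1))) M] [IsManifold (𝓡 (n + 1)) ∞ M]
    (g : LorentzianMetric n M) (T : g.TimeOrientation) (p₀ : M) :
    ∃ V : Set M, IsOpen V ∧ p₀ ∈ V ∧
      g.GeodesicallyConvex V ∧
      (∀ p ∈ V, ∀ q ∈ V,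
        (q ∈ g.chronologicalFuture T V p ↔
          ∃ c : ℝ → M, g.IsGeodesic c ∧ LorentzianMetric.Connects V p q c ∧
            g.IsTimelike c ∧ g.IsFutureDirected T c)) ∧
      (∀ p ∈ V,
        g.causalFuture T V p = closure (g.chronologicalFuture T V p) ∩ V) ∧
      (∀ p ∈ V, ∀ q ∈ V,
        (q ∈ g.causalFuture T V p ↔
          ∃ c : ℝ → M, g.IsGeodesic c ∧ LorentzianMetric.Connects V p q c ∧
            (g.IsTimelike c ∨ g.IsNull c) ∧ g.IsFutureDirected T c)) := by
  obtain ⟨T₀, a, K, N, h⟩ := g.exists_causalChart T p₀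
  refine ⟨LorentzianMetric.chartBall n p₀ (a / 16), LorentzianMetric.isOpen_chartBall p₀ _,
    h.mem_chartBall, h.geodesicallyConvex, fun p hp q hq => h.mem_chronologicalFuture_iff hp hq,
    fun p hp => ?_, fun p hp q hq => ⟨fun hJ => ?_, fun hc =>
      LorentzianMetric.mem_causalFuture_of_geodesic hc⟩⟩
  -- The closure in `V` is the closure in `M` intersected with `V`. A point of it is reached by a
  -- causal geodesic, which is itself a causal curve; together with `causalFuture_subset_closure`
  -- this closes the circle for statements 3 and 4.
  · refine Subset.antisymm
      (fun q hq => ⟨h.causalFuture_subset_closure hq, LorentzianMetric.causalFuture_subset hq⟩)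
      fun q hq => ?_
    exact LorentzianMetric.mem_causalFuture_of_geodesic (h.exists_causal_geodesic hp hq.2 hq.1)
  · exact h.exists_causal_geodesic hp hq (h.causalFuture_subset_closure hJ)
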